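/- For vectors $x_1,\dots,x_m\in\mathbb R^n$ let $\operatorname{absconv}\{x_1,\dots,x_m\}=\{\sum_{i} a_i x_i : \sum_{i}|a_i|\le 1\}$, let $e_1,\dots,e_n$ be the canonical basis of $\mathbb R^n$, and let $\|\cdot\|$ be the Euclidean norm. There exists an absolute constant $C>0$ such that the following holds. Let $k,n,N$ be integers with $1\le k\le n$ and $2n\le N\le n e^{k}$, let $g_1,\dots,g_N$ be independent standard Gaussian random vectors in $\mathbb R^n$ on a probability space $(\Omega,\mathbb P)$, and put $$Z_N(\omega)=\operatorname{absconv}\{\sqrt n\,e_1,\dots,\sqrt n\,e_n,g_1(\omega),\dots,g_N(\omega)\},\qquad \Omega_0=\Big\{\omega\in\Omega : \tfrac{\sqrt n}{4}\le\|g_i(\omega)\|\le 2\sqrt n\ \text{ for all } i\le N\Big\}.$$ Then there is an event $\Omega_1\subset\Omega_0$ with $$\mathbb P(\Omega_1)\ge 1-4N e^{-n/4}$$ such that for every $\omega\in\Omega_1$ and every orthogonal projection $Q$ of rank $k$ on $\mathbb R^n$, $$|QZ_N(\omega)|^{1/k}\le C\max\left\{\frac{\sqrt n}{k}\sqrt{\log\log\log\Big(\frac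 Nk\Big)},\ \frac{\sqrt{\log(N/k)}}{\sqrt k}\right\},$$ where $|\cdot|$ denotes $k$-dimensional volume, and $\sqrt{\log\log\log(N/k)}$ is read as $0$ when $N/k<e^{e}$ (where the triple logarithm is negative or undefined). -/

import Mathlib

open MeasureTheory ProbabilityTheory

noncomputable section

/-- The absolute convex hull of a finite family of vectors,
`{∑ i, a i • v i : ∑ i, |a i| ≤ 1}`. -/
def absconv {ι E : Type*} [Fintype ι] [AddCommGroup E] [Module ℝ E] (v : ι → E) : Set E :=
  {x | ∃ a : ι → ℝ, ∑ i, |a i| ≤ 1 ∧ x = ∑ i, a i • v i}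

/-- The symmetric polytope `absconv {√n e₁, …, √n eₙ, x₁, …, x_N}` in `ℝⁿ`. -/
def gluskinPolytope (n N : ℕ) (x : Fin N → EuclideanSpace ℝ (Fin n)) :
    Set (EuclideanSpace ℝ (Fin n)) :=
  absconv (Sum.elim
    (fun i : Fin n => √(n : ℝ) • (EuclideanSpace.single i 1 : EuclideanSpace ℝ (Fin n))) x)

/-- The orthogonal projections of rank `k` on `ℝⁿ` (self-adjoint idempotent operators whose
range has dimension `k`). -/
def orthProjections (n k : ℕ) : Set (EuclideanSpace ℝ (Fin n) →L[ℝ] EuclideanSpace ℝ (Fin n)) :=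
  {Q | IsStarProjection Q ∧ Module.finrank ℝ (LinearMap.range Q.toLinearMap) = k}

/-- The event that all the vectors `g i` satisfy `√n / 4 ≤ ‖g i‖ ≤ 2 √n`
(`‖·‖` is the Euclidean norm). -/
def normEvent {Ω : Type*} (n N : ℕ) (g : Fin N → Ω → EuclideanSpace ℝ (Fin n)) : Set Ω :=
  {ω | ∀ i, √(n : ℝ) / 4 ≤ ‖g i ω‖ ∧ ‖g i ω‖ ≤ 2 * √(n : ℝ)}

/-- `√(log log log x)` for `x ≥ e ^ e`, the range on which the triple logarithm is defined and
nonnegative, and `0` for smaller `x`. -/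
def sqrtLogLogLog (x : ℝ) : ℝ :=
  if Real.exp (Real.exp 1) ≤ x then √(Real.log (Real.log (Real.log x))) else 0

end

open MeasureTheory ProbabilityTheory
open scoped Pointwise RealInnerProductSpace ENNReal NNReal

/-! Write L = log(N/k). A rank-k orthogonal projection is an isometric copy of a contraction T onto
ℝᵏ with ∑‖T eᵢ‖² = k, so the volume in question is that of the absolute convex hull of the n + N
image points, all of norm at most 2√n on the norm event. It is bounded by covering this hull with
exp(O(k)) balls and using that a ball of radius ρ in ℝᵏ has volume at most (Cρ/√k)ᵏ.

The cover comes from sorting the image points by length into shells of ratio 1/4. If shell j has O(k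
32ʲ) points, Maurey's method with about k 4⁻ʲ summands covers its hull by exp(O(k 2⁻ʲ)) balls of
radius O(2⁻ʲ √n/√k); both quantities are summable in j. Points of length O(√(k + L)) are treated
together with k/(1 + L) summands (`ballCover_absconv_of_shells`).

The shell counts must hold for all T simultaneously. For the basis vectors they follow from ∑‖T eᵢ‖²
= k. For the Gaussian vectors, for a fixed T it is very unlikely that m vectors all have long
images; a union bound over a net of the operator unit ball and over index sets of size m, with m =
640 k 32ʲ, makes this uniform (`exists_small_event_card_le`).

The result is |QZ|^(1/k) ≤ C(√n/k + √(L/k)), without the triple logarithm. That factor enters only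
in `exists_const_le_max_sqrtLogLogLog`: it is at least 1 for large N/k, and for bounded N/k the
second term dominates √n/k. -/

/-- `A` is covered by at most `κ` closed balls of radius `ρ`. -/
def BallCover {E : Type*} [SeminormedAddCommGroup E] (A : Set E) (κ ρ : ℝ) : Prop :=
  ∃ F : Finset E, (F.card : ℝ) ≤ κ ∧ ∀ x ∈ A, ∃ y ∈ F, ‖x - y‖ ≤ ρ

/-! ### Ball covers under Minkowski sums. -/

namespace BallCover

variable {E : Type*} [SeminormedAddCommGroup E]

theorem mono {A B : Set E} {κ κ' ρ ρ' : ℝ} (h : BallCover A κ ρ) (hB : B ⊆ A) (hκ : κ ≤ κ')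
    (hρ : ρ ≤ ρ') : BallCover B κ' ρ' := by
  obtain ⟨F, hF, hc⟩ := h
  refine ⟨F, hF.trans hκ, fun x hx => ?_⟩
  obtain ⟨y, hy, hxy⟩ := hc x (hB hx)
  exact ⟨y, hy, hxy.trans hρ⟩

theorem add {A B : Set E} {κ κ' ρ ρ' : ℝ} (hA : BallCover A κ ρ) (hB : BallCover B κ' ρ') :
    BallCover (A + B) (κ * κ') (ρ + ρ') := by
  classical
  obtain ⟨F, hF, hFc⟩ := hA
  obtain ⟨G, hG, hGc⟩ := hB
  refine ⟨Finset.image₂ (· + ·) F G, ?_, ?_⟩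
  · calc ((Finset.image₂ (· + ·) F G).card : ℝ) ≤ (F.card * G.card : ℕ) := by
          exact_mod_cast Finset.card_image₂_le _ _ _
      _ ≤ κ * κ' := by
          push_cast
          exact mul_le_mul hF hG (by positivity) (le_trans (by positivity) hF)
  · rintro _ ⟨a, ha, b, hb, rfl⟩
    obtain ⟨y, hy, hay⟩ := hFc a ha
    obtain ⟨z, hz, hbz⟩ := hGc b hb
    refine ⟨y + z, Finset.mem_image₂_of_mem hy hz, ?_⟩
    have : a + b - (y + z) = (a - y) + (b - z) := by abel
    simp only [this]
    exact (norm_add_le _ _).trans (add_le_add hay hbz)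

theorem sum {κ : Type*} (s : Finset κ) {A : κ → Set E} {a ρ : κ → ℝ}
    (h : ∀ c ∈ s, BallCover (A c) (Real.exp (a c)) (ρ c)) :
    BallCover (∑ c ∈ s, A c) (Real.exp (∑ c ∈ s, a c)) (∑ c ∈ s, ρ c) := by
  classical
  induction s using Finset.induction_on with
  | empty => exact ⟨{0}, by simp, by simp⟩
  | insert c s hc ih =>
    rw [Finset.sum_insert hc, Finset.sum_insert hc, Finset.sum_insert hc, Real.exp_add]
    exact (h c (by simp)).add (ih fun d hd => h d (by simp [hd]))

end BallCover

/-- The vectors `0` and `± v i`. -/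
def signedPoints {E ι : Type*} [NormedAddCommGroup E] (v : ι → E) : Option (ι × Bool) → E
  | none => 0
  | some (i, true) => v i
  | some (i, false) => -v i

theorem norm_signedPoints_le {E ι : Type*} [NormedAddCommGroup E] {v : ι → E} {R : ℝ} (hR : 0 ≤ R) (hv : ∀ i, ‖v i‖ ≤ R)
    (z : Option (ι × Bool)) : ‖signedPoints v z‖ ≤ R := by
  rcases z with _ | ⟨i, _ | _⟩ <;> simp [signedPoints, hR, hv]

/-! ### Maurey's empirical method. -/

section Maurey

variable {E : Type*} [NormedAddCommGroup E] [InnerProductSpace ℝ E] {ι : Type*} [Fintype ι]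

theorem norm_le_of_mem_absconv {v : ι → E} {R : ℝ} (hR : 0 ≤ R) (hv : ∀ i, ‖v i‖ ≤ R)
    {x : E} (hx : x ∈ absconv v) : ‖x‖ ≤ R := by
  obtain ⟨a, ha, rfl⟩ := hx
  calc ‖∑ i, a i • v i‖ ≤ ∑ i, |a i| * R := by
        refine (norm_sum_le _ _).trans (Finset.sum_le_sum fun i _ => ?_)
        rw [norm_smul, Real.norm_eq_abs]
        gcongr
        exact hv i
    _ ≤ 1 * R := by rw [← Finset.sum_mul]; gcongr
    _ = R := one_mul R

/-- A linear functional on the hull attains its minimum at one of the points ±vᵢ; the point 0 takes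
care of the case where all these inner products vanish or the family is empty. -/
theorem exists_signedPoints_inner_le {v : ι → E} {x : E} (hx : x ∈ absconv v) (S : E) :
    ∃ z, ⟪S, signedPoints v z⟫ ≤ ⟪S, x⟫ := by
  by_contra! h
  have h0 : ⟪S, x⟫ < 0 := by simpa [signedPoints] using h none
  have hi : ∀ i, |⟪S, v i⟫| < -⟪S, x⟫ := fun i => by
    have h1 : ⟪S, x⟫ < ⟪S, v i⟫ := h (some (i, true))
    have h2 : ⟪S, x⟫ < ⟪S, -v i⟫ := h (some (i, false))
    rw [inner_neg_right] at h2
    rw [abs_lt]; constructor <;> linarith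
  obtain ⟨a, ha, rfl⟩ := hx
  set c := -⟪S, ∑ i, a i • v i⟫ with hc
  have hcle : c ≤ ∑ i, |a i| * |⟪S, v i⟫| := by
    rw [hc, inner_sum]
    refine (neg_le_abs _).trans ((Finset.abs_sum_le_sum_abs _ _).trans (le_of_eq ?_))
    exact Finset.sum_congr rfl fun i _ => by rw [inner_smul_right, abs_mul]
  have hle : ∑ i, |a i| * |⟪S, v i⟫| ≤ ∑ i, |a i| * c :=
    Finset.sum_le_sum fun i _ => mul_le_mul_of_nonneg_left (hi i).le (abs_nonneg _)
  by_cases hz : ∀ i, a i = 0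
  · simp [hz] at hcle
    linarith
  · push Not at hz
    obtain ⟨i, hi0⟩ := hz
    have hlt : ∑ i, |a i| * |⟪S, v i⟫| < ∑ i, |a i| * c :=
      Finset.sum_lt_sum (fun i _ => mul_le_mul_of_nonneg_left (hi i).le (abs_nonneg _))
        ⟨i, Finset.mem_univ i, mul_lt_mul_of_pos_left (hi i) (abs_pos.2 hi0)⟩
    rw [← Finset.sum_mul] at hlt
    nlinarith

/-- A greedy choice replaces random sampling: each new point z is taken with ⟪S, z - x⟫ ≤ 0, where S
is the current error, so the squared error grows by at most (2R)² per step. Only the multiset of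
chosen points matters, which keeps the later count down to a binomial coefficient. -/
theorem exists_sym_norm_sub_le {v : ι → E} {R : ℝ} (hR : 0 ≤ R) (hv : ∀ i, ‖v i‖ ≤ R) {x : E}
    (hx : x ∈ absconv v) (q : ℕ) :
    ∃ s : Sym (Option (ι × Bool)) q,
      ‖((s : Multiset (Option (ι × Bool))).map (signedPoints v)).sum - (q : ℝ) • x‖ ^ 2
        ≤ q * (2 * R) ^ 2 := by
  induction q with
  | zero => exact ⟨Sym.nil, by simp⟩
  | succ q ih =>
    obtain ⟨s, hs⟩ := ih
    set S := ((s : Multiset (Option (ι × Bool))).map (signedPoints v)).sum - (q : ℝ) • x with hS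
    obtain ⟨z, hz⟩ := exists_signedPoints_inner_le hx S
    refine ⟨z ::ₛ s, ?_⟩
    have heq : (((z ::ₛ s : Sym (Option (ι × Bool)) (q + 1)) :
        Multiset (Option (ι × Bool))).map (signedPoints v)).sum =
        S + (signedPoints v z - x) + ((q + 1 : ℕ) : ℝ) • x := by
      simp only [Sym.coe_cons, Multiset.map_cons, Multiset.sum_cons, hS]
      push_cast
      module
    rw [heq, add_sub_cancel_right, norm_add_sq_real, inner_sub_right]
    have h1 : ‖signedPoints v z - x‖ ≤ 2 * R := by
      refine (norm_sub_le _ _).trans ?_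
      linarith [norm_signedPoints_le hR hv z, norm_le_of_mem_absconv hR hv hx]
    have h2 : ‖signedPoints v z - x‖ ^ 2 ≤ (2 * R) ^ 2 := by gcongr
    push_cast
    nlinarith

theorem ballCover_absconv_choose {v : ι → E} {R : ℝ} (hR : 0 ≤ R) (hv : ∀ i, ‖v i‖ ≤ R) {q : ℕ}
    (hq : 0 < q) :
    BallCover (absconv v) ((2 * Fintype.card ι + q).choose q : ℕ) (2 * R / √q) := by
  classical
  refine ⟨Finset.univ.image fun s : Sym (Option (ι × Bool)) q =>
    (q : ℝ)⁻¹ • ((s : Multiset (Option (ι × Bool))).map (signedPoints v)).sum, ?_, ?_⟩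
  · have h : Fintype.card (Sym (Option (ι × Bool)) q) = (2 * Fintype.card ι + q).choose q := by
      rw [Sym.card_sym_eq_choose]
      congr 1
      simp
      omega
    exact_mod_cast Finset.card_image_le.trans (by rw [Finset.card_univ, h])
  · intro x hx
    obtain ⟨s, hs⟩ := exists_sym_norm_sub_le hR hv hx q
    refine ⟨_, Finset.mem_image_of_mem _ (Finset.mem_univ s), ?_⟩
    have hq' : (0 : ℝ) < q := by exact_mod_cast hq
    set S := ((s : Multiset (Option (ι × Bool))).map (signedPoints v)).sum
    have h1 : x - (q : ℝ)⁻¹ • S = (-(q : ℝ)⁻¹) • (S - (q : ℝ) • x) := by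
      rw [smul_sub, smul_smul]
      field_simp
      module
    have h2 : ‖S - (q : ℝ) • x‖ ≤ √q * (2 * R) := by
      refine le_of_sq_le_sq ?_ (by positivity)
      rw [mul_pow, Real.sq_sqrt hq'.le]
      exact hs
    rw [h1, norm_smul, norm_neg, norm_inv, Real.norm_of_nonneg hq'.le]
    calc (q : ℝ)⁻¹ * ‖S - (q : ℝ) • x‖ ≤ (q : ℝ)⁻¹ * (√q * (2 * R)) := by gcongr
      _ = 2 * R / √q := by
        have h3 : √(q : ℝ) * √q = q := Real.mul_self_sqrt hq'.le
        have h4 : 0 < √(q : ℝ) := Real.sqrt_pos.2 hq'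
        field_simp
        nlinarith

theorem Nat.choose_le_exp_mul_div_pow (a : ℕ) {q : ℕ} (hq : 0 < q) :
    (a.choose q : ℝ) ≤ (Real.exp 1 * a / q) ^ q := by
  have hq' : (0 : ℝ) < q := by exact_mod_cast hq
  have h := Real.pow_div_factorial_le_exp (q : ℝ) hq'.le q
  have hf : (0 : ℝ) < (q.factorial : ℝ) := by exact_mod_cast q.factorial_pos
  calc (a.choose q : ℝ) ≤ (a : ℝ) ^ q / q.factorial := Nat.choose_le_pow_div q a
    _ = (a / q : ℝ) ^ q * ((q : ℝ) ^ q / q.factorial) := by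
      rw [div_pow]; field_simp
    _ ≤ (a / q : ℝ) ^ q * Real.exp q := by gcongr
    _ = (Real.exp 1 * a / q) ^ q := by
      rw [← Real.exp_one_pow q, ← mul_pow]; congr 1; ring

/-- Maurey's empirical method: the absolute convex hull of at most `B` vectors of norm at most `R`
is covered by few balls of radius `4 R / √p`. -/
theorem ballCover_absconv {v : ι → E} {R B p : ℝ} (hR : 0 ≤ R) (hv : ∀ i, ‖v i‖ ≤ R)
    (hB : Fintype.card ι ≤ B) (hp : 0 < p) (hpB : p ≤ B) :
    BallCover (absconv v) (Real.exp (p * Real.log (6 * Real.exp 1 * B / p))) (4 * R / √p) := by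
  have he : (1 : ℝ) ≤ Real.exp 1 := Real.one_le_exp (by norm_num)
  have hX : 1 ≤ 6 * Real.exp 1 * B / p := by
    rw [le_div_iff₀ hp]; nlinarith
  -- For p < 1 a single ball at the origin is large enough. Otherwise q = ⌊p⌋ summands are used, and
  -- p ≤ 2q accounts for the constants 6 and 4.
  rcases lt_or_ge p 1 with h1 | h1
  · refine ⟨{0}, ?_, fun x hx => ⟨0, by simp, ?_⟩⟩
    · simpa using mul_nonneg hp.le (Real.log_nonneg hX)
    · rw [sub_zero]
      refine (norm_le_of_mem_absconv hR hv hx).trans ?_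
      rw [le_div_iff₀ (Real.sqrt_pos.2 hp)]
      have : √p ≤ 1 := Real.sqrt_le_one.2 h1.le
      nlinarith
  · set q := ⌊p⌋₊ with hq
    have hq1 : 1 ≤ q := Nat.le_floor (by simpa using h1)
    have hqp : (q : ℝ) ≤ p := Nat.floor_le hp.le
    have hpq : p ≤ 2 * q := by
      have h2 := Nat.lt_floor_add_one p
      have h3 : (1 : ℝ) ≤ q := by exact_mod_cast hq1
      rw [← hq] at h2
      linarith
    have hq0 : (0 : ℝ) < q := by linarith
    refine (ballCover_absconv_choose hR hv hq1).mono subset_rfl ?_ ?_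
    · calc (((2 * Fintype.card ι + q).choose q : ℕ) : ℝ)
          ≤ (Real.exp 1 * (2 * Fintype.card ι + q : ℕ) / q) ^ q :=
            Nat.choose_le_exp_mul_div_pow _ hq1
        _ ≤ (6 * Real.exp 1 * B / p) ^ q := by
            gcongr ?_ ^ q
            rw [div_le_div_iff₀ hq0 hp]
            push_cast
            have : (2 * (Fintype.card ι : ℝ) + q) ≤ 3 * B := by linarith
            have hB0 : 0 ≤ B := hp.le.trans hpB
            calc Real.exp 1 * (2 * (Fintype.card ι : ℝ) + q) * p
                ≤ Real.exp 1 * (3 * B) * (2 * q) := by gcongr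
              _ = _ := by ring
        _ = (6 * Real.exp 1 * B / p) ^ (q : ℝ) := (Real.rpow_natCast _ _).symm
        _ ≤ (6 * Real.exp 1 * B / p) ^ p := Real.rpow_le_rpow_of_exponent_le hX hqp
        _ = _ := by rw [Real.rpow_def_of_pos (by linarith), mul_comm]
    · rw [div_le_div_iff₀ (Real.sqrt_pos.2 hq0) (Real.sqrt_pos.2 hp)]
      have : √p ≤ 2 * √(q : ℝ) := by
        rw [Real.sqrt_le_left (by positivity), mul_pow, Real.sq_sqrt hq0.le]
        linarith
      nlinarith [Real.sqrt_nonneg (q : ℝ)]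

/-- Grouping the coefficients by label leaves each group with total absolute weight at most 1. -/
theorem absconv_subset_sum {κ : Type*} [DecidableEq κ] (v : ι → E) (l : ι → κ) (s : Finset κ)
    (hl : ∀ i, l i ∈ s) :
    absconv v ⊆ ∑ c ∈ s, absconv fun i : {i // l i = c} => v i := by
  rintro x ⟨a, ha, rfl⟩
  rw [Set.mem_finsetSum]
  have hfib : ∀ f : ι → E, ∑ c ∈ s, ∑ i : {i // l i = c}, f i = ∑ i, f i := fun f => by
    rw [← Finset.sum_fiberwise_of_maps_to (fun i _ => hl i)]
    exact Finset.sum_congr rfl fun c _ =>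
      (Finset.sum_subtype _ (by simp) _).symm
  refine ⟨fun c => ∑ i : {i // l i = c}, a i • v i, fun {c} _ =>
    ⟨fun i => a i, ?_, rfl⟩, hfib fun i => a i • v i⟩
  refine le_trans ?_ ha
  rw [← Finset.sum_subtype (Finset.univ.filter fun i => l i = c) (by simp) fun i => |a i|]
  exact Finset.sum_le_sum_of_subset_of_nonneg (Finset.subset_univ _) fun _ _ _ => abs_nonneg _

end Maurey

/-! ### Volume of balls and of covered sets. -/

theorem volume_closedBall_le {k : ℕ} (hk : 0 < k) (x : EuclideanSpace ℝ (Fin k)) {ρ : ℝ}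
    (hρ : 0 < ρ) :
    volume (Metric.closedBall x ρ) ≤
      ENNReal.ofReal ((Real.exp 1 * √Real.pi * ρ / √k) ^ k) := by
  have hk' : (0 : ℝ) < k := by exact_mod_cast hk
  -- With this b the Gaussian exp(-b‖v‖²) is at least exp(-k) on the ball, so its total integral
  -- bounds the volume.
  set b : ℝ := k / ρ ^ 2 with hb
  have hb0 : 0 < b := by positivity
  rw [Measure.addHaar_closedBall_center]
  have hint := GaussianFourier.integral_rexp_neg_mul_sq_norm (V := EuclideanSpace ℝ (Fin k)) hb0
  have hi : Integrable fun v : EuclideanSpace ℝ (Fin k) => Real.exp (-b * ‖v‖ ^ 2) := by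
    by_contra h
    rw [integral_undef h] at hint
    have : 0 < (Real.pi / b) ^ (Module.finrank ℝ (EuclideanSpace ℝ (Fin k)) / 2 : ℝ) := by
      positivity
    linarith
  have hfin : volume (Metric.closedBall (0 : EuclideanSpace ℝ (Fin k)) ρ) ≠ ⊤ :=
    measure_closedBall_lt_top.ne
  have h1 : Real.exp (-k) * volume.real (Metric.closedBall (0 : EuclideanSpace ℝ (Fin k)) ρ) ≤
      (Real.pi / b) ^ (k / 2 : ℝ) := by
    calc Real.exp (-k) * volume.real (Metric.closedBall (0 : EuclideanSpace ℝ (Fin k)) ρ)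
        = ∫ v in Metric.closedBall (0 : EuclideanSpace ℝ (Fin k)) ρ, Real.exp (-k) := by
          rw [setIntegral_const, smul_eq_mul, mul_comm]
      _ ≤ ∫ v in Metric.closedBall (0 : EuclideanSpace ℝ (Fin k)) ρ, Real.exp (-b * ‖v‖ ^ 2) := by
          refine setIntegral_mono_on (by simpa using hfin.lt_top) hi.integrableOn
            measurableSet_closedBall fun v hv => ?_
          rw [mem_closedBall_zero_iff] at hv
          apply Real.exp_le_exp.2
          have : b * ‖v‖ ^ 2 ≤ b * ρ ^ 2 := by gcongr
          have h2 : b * ρ ^ 2 = k := by rw [hb]; field_simp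
          linarith
      _ ≤ ∫ v, Real.exp (-b * ‖v‖ ^ 2) :=
          setIntegral_le_integral hi (Filter.Eventually.of_forall fun v => (Real.exp_pos _).le)
      _ = _ := by rw [hint]; simp
  rw [← ENNReal.ofReal_toReal hfin]
  apply ENNReal.ofReal_le_ofReal
  have h2 : (Real.pi / b) ^ (k / 2 : ℝ) = (√Real.pi * ρ / √k) ^ k := by
    have : (√Real.pi * ρ / √k) = √(Real.pi / b) := by
      rw [hb, div_div_eq_mul_div, Real.sqrt_div (by positivity), Real.sqrt_mul (by positivity),
        Real.sqrt_sq hρ.le]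
    rw [this, Real.sqrt_eq_rpow, ← Real.rpow_natCast, ← Real.rpow_mul (by positivity)]
    congr 1; ring
  rw [h2, Real.exp_neg, inv_mul_le_iff₀ (Real.exp_pos _), ← Real.exp_one_pow, ← mul_pow] at h1
  have h3 : Real.exp 1 * √Real.pi * ρ / √k = Real.exp 1 * (√Real.pi * ρ / √k) := by ring
  rw [h3]
  exact h1

theorem BallCover.volume_le {k : ℕ} (hk : 0 < k) {A : Set (EuclideanSpace ℝ (Fin k))} {κ ρ : ℝ}
    (h : BallCover A κ ρ) (hρ : 0 < ρ) :
    volume A ≤ ENNReal.ofReal (κ * (Real.exp 1 * √Real.pi * ρ / √k) ^ k) := by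
  obtain ⟨F, hF, hc⟩ := h
  have hsub : A ⊆ ⋃ y ∈ F, Metric.closedBall y ρ := fun x hx => by
    obtain ⟨y, hy, hxy⟩ := hc x hx
    simp only [Set.mem_iUnion]
    exact ⟨y, hy, by rwa [Metric.mem_closedBall, dist_eq_norm]⟩
  calc volume A ≤ ∑ y ∈ F, volume (Metric.closedBall y ρ) :=
        (measure_mono hsub).trans (measure_biUnion_finset_le _ _)
    _ ≤ ∑ _y ∈ F, ENNReal.ofReal ((Real.exp 1 * √Real.pi * ρ / √k) ^ k) :=
        Finset.sum_le_sum fun y _ => volume_closedBall_le hk y hρ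
    _ = ENNReal.ofReal (F.card * (Real.exp 1 * √Real.pi * ρ / √k) ^ k) := by
        rw [Finset.sum_const, nsmul_eq_mul, ENNReal.ofReal_mul (by positivity),
          ENNReal.ofReal_natCast]
    _ ≤ _ := ENNReal.ofReal_le_ofReal (by gcongr)

theorem natCast_mul_quarter_pow_le (j : ℕ) : (j : ℝ) * (1 / 4) ^ j ≤ (1 / 2) ^ j := by
  have h : (j : ℝ) ≤ 2 ^ j := by exact_mod_cast j.lt_two_pow_self.le
  calc (j : ℝ) * (1 / 4) ^ j ≤ 2 ^ j * (1 / 4) ^ j := by gcongr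
    _ = (1 / 2) ^ j := by rw [← mul_pow]; norm_num

theorem sum_half_pow_le (J : ℕ) : ∑ j ∈ Finset.range J, (1 / 2 : ℝ) ^ j ≤ 2 := by
  refine (Summable.sum_le_tsum _ (fun _ _ => by positivity) summable_geometric_two).trans ?_
  rw [tsum_geometric_two]

/-! ### Covering a hull shell by shell. -/

section Shells

variable {E : Type*} [NormedAddCommGroup E] [InnerProductSpace ℝ E] {ι : Type*} [Fintype ι]

/-- Maurey's method with p = k 4⁻ʲ. The logarithm of the ratio of count to p grows only linearly in
j, which 4⁻ʲ absorbs while leaving 2⁻ʲ. -/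
theorem ballCover_absconv_shell {v : ι → E} {D c : ℝ} {k : ℕ} (j : ℕ) (hk : 0 < k) (hc : 1 ≤ c)
    (hD : 0 ≤ D) (hv : ∀ i, ‖v i‖ ≤ D * (1 / 4) ^ j)
    (hcard : (Fintype.card ι : ℝ) ≤ c * k * 32 ^ j) :
    BallCover (absconv v) (Real.exp (k * (Real.log (6 * Real.exp 1 * c) + 5) * (1 / 2) ^ j))
      (4 * D / √k * (1 / 2) ^ j) := by
  have hk' : (0 : ℝ) < k := by exact_mod_cast hk
  have h4 : ((1 / 4 : ℝ) ^ j) ≤ 1 := pow_le_one₀ (by norm_num) (by norm_num)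
  have h32 : (1 : ℝ) ≤ 32 ^ j := one_le_pow₀ (by norm_num)
  have he : (1 : ℝ) ≤ Real.exp 1 := Real.one_le_exp (by norm_num)
  have hlog0 : 0 ≤ Real.log (6 * Real.exp 1 * c) := Real.log_nonneg (by nlinarith)
  have hp : (0 : ℝ) < k * (1 / 4) ^ j := by positivity
  have hpB : (k : ℝ) * (1 / 4) ^ j ≤ c * k * 32 ^ j := by
    have : (1 : ℝ) ≤ c * 32 ^ j := one_le_mul_of_one_le_of_one_le hc h32
    nlinarith
  refine (ballCover_absconv (by positivity) hv hcard hp hpB).mono subset_rfl ?_ (le_of_eq ?_)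
  · apply Real.exp_le_exp.2
    have h1 : 6 * Real.exp 1 * (c * k * 32 ^ j) / (k * (1 / 4) ^ j) =
        6 * Real.exp 1 * c * 128 ^ j := by
      have : (128 : ℝ) ^ j = 32 ^ j * 4 ^ j := by rw [← mul_pow]; norm_num
      rw [this, one_div, inv_pow]
      field_simp
    have h128 : Real.log 128 ≤ 5 := by
      have : (128 : ℝ) = 2 ^ 7 := by norm_num
      rw [this, Real.log_pow]
      have := Real.log_two_lt_d9
      push_cast
      linarith
    rw [h1, Real.log_mul (by positivity) (by positivity), Real.log_pow]
    have h2 := natCast_mul_quarter_pow_le j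
    have h3 : ((1 / 4 : ℝ) ^ j) ≤ (1 / 2) ^ j := by gcongr; norm_num
    calc (k : ℝ) * (1 / 4) ^ j * (Real.log (6 * Real.exp 1 * c) + j * Real.log 128)
        ≤ k * (1 / 4) ^ j * (Real.log (6 * Real.exp 1 * c) + j * 5) := by gcongr
      _ = k * (Real.log (6 * Real.exp 1 * c) * (1 / 4) ^ j + 5 * (j * (1 / 4) ^ j)) := by ring
      _ ≤ k * (Real.log (6 * Real.exp 1 * c) * (1 / 2) ^ j + 5 * (1 / 2) ^ j) := by gcongr
      _ = _ := by ring
  · have : √((k : ℝ) * (1 / 4) ^ j) = √k * (1 / 2) ^ j := by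
      rw [Real.sqrt_mul hk'.le]
      congr 1
      have : ((1 / 4 : ℝ) ^ j) = ((1 / 2) ^ j) ^ 2 := by
        rw [← pow_mul, mul_comm, pow_mul]; norm_num
      rw [this, Real.sqrt_sq (by positivity)]
    rw [this]
    have h2 : ((1 / 4 : ℝ) ^ j) = (1 / 2) ^ j * (1 / 2) ^ j := by rw [← mul_pow]; norm_num
    rw [h2]
    have : 0 < √(k : ℝ) := Real.sqrt_pos.2 hk'
    field_simp

/-- Maurey's method with p = k/(1 + L), chosen so that p times the logarithmic factor, which is O(1
+ L), stays O(k). -/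
theorem ballCover_absconv_small {v : ι → E} {r L : ℝ} {k : ℕ} (hk : 0 < k) (hL : 0 ≤ L)
    (hr : 0 ≤ r) (hv : ∀ i, ‖v i‖ ≤ r) (hcard : (Fintype.card ι : ℝ) ≤ 2 * k * Real.exp L) :
    BallCover (absconv v) (Real.exp (k * 4)) (4 * r * √(1 + L) / √k) := by
  have hk' : (0 : ℝ) < k := by exact_mod_cast hk
  have hp : (0 : ℝ) < k / (1 + L) := by positivity
  have hpB : (k : ℝ) / (1 + L) ≤ 2 * k * Real.exp L := by
    have h1 : (1 : ℝ) ≤ Real.exp L := Real.one_le_exp hL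
    have h2 : (k : ℝ) / (1 + L) ≤ k := div_le_self hk'.le (by linarith)
    nlinarith
  refine (ballCover_absconv hr hv hcard hp hpB).mono subset_rfl ?_ (le_of_eq ?_)
  · apply Real.exp_le_exp.2
    have h1 : 6 * Real.exp 1 * (2 * k * Real.exp L) / (k / (1 + L)) =
        12 * Real.exp 1 * Real.exp L * (1 + L) := by
      field_simp
      ring
    have h12 : Real.log 12 ≤ 3 := by
      have : Real.log 12 ≤ Real.log (2 ^ 4) := Real.log_le_log (by norm_num) (by norm_num)
      rw [Real.log_pow] at this
      have := Real.log_two_lt_d9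
      push_cast at *
      linarith
    have hl : Real.log (1 + L) ≤ L := by
      have := Real.log_le_sub_one_of_pos (show 0 < 1 + L by linarith)
      linarith
    rw [h1, Real.log_mul (by positivity) (by positivity),
      Real.log_mul (by positivity) (by positivity), Real.log_mul (by positivity) (by positivity),
      Real.log_exp, Real.log_exp, div_mul_eq_mul_div, div_le_iff₀ (by positivity)]
    have : Real.log 12 + 1 + L + Real.log (1 + L) ≤ 4 * (1 + L) := by linarith
    nlinarith
  · rw [Real.sqrt_div hk'.le, div_div_eq_mul_div]

theorem ballCover_absconv_of_shells {y : ι → E} {k J : ℕ} {D r c L : ℝ} (hk : 0 < k) (hc : 1 ≤ c)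
    (hL : 0 ≤ L) (hD : 0 ≤ D) (hy : ∀ i, ‖y i‖ ≤ D)
    (hcount : ∀ j < J, (Fintype.card {i // D * (1 / 4) ^ (j + 1) < ‖y i‖} : ℝ) ≤ c * k * 32 ^ j)
    (hr : D * (1 / 4) ^ J ≤ r) (hcard : (Fintype.card ι : ℝ) ≤ 2 * k * Real.exp L) :
    BallCover (absconv y) (Real.exp (k * (2 * (Real.log (6 * Real.exp 1 * c) + 5) + 4)))
      (8 * D / √k + 4 * r * √(1 + L) / √k) := by
  classical
  have hk' : (0 : ℝ) < k := by exact_mod_cast hk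
  have he : (1 : ℝ) ≤ Real.exp 1 := Real.one_le_exp (by norm_num)
  have hlog0 : 0 ≤ Real.log (6 * Real.exp 1 * c) := Real.log_nonneg (by nlinarith)
  set K := Real.log (6 * Real.exp 1 * c) + 5
  -- The search is capped at J, so label J gathers all remaining short vectors. The default value 0
  -- is harmless because the bound at 0 always holds.
  set l : ι → ℕ := fun i => Nat.findGreatest (fun j => ‖y i‖ ≤ D * (1 / 4) ^ j) J with hl
  have hspec : ∀ i, ‖y i‖ ≤ D * (1 / 4) ^ l i := fun i =>
    Nat.findGreatest_spec (P := fun j => ‖y i‖ ≤ D * (1 / 4) ^ j) (Nat.zero_le J)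
      (by simpa using hy i)
  have hgt : ∀ i, l i < J → D * (1 / 4) ^ (l i + 1) < ‖y i‖ := fun i hi => by
    have := Nat.findGreatest_is_greatest (P := fun j => ‖y i‖ ≤ D * (1 / 4) ^ j) (n := J)
      (k := l i + 1) (Nat.lt_succ_self _) hi
    exact not_le.1 this
  have hsub := absconv_subset_sum y l (Finset.range (J + 1)) fun i =>
    Finset.mem_range.2 (Nat.lt_succ_of_le (Nat.findGreatest_le J))
  rw [Finset.sum_range_succ] at hsub
  have hshell : ∀ j ∈ Finset.range J, BallCover (absconv fun i : {i // l i = j} => y i)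
      (Real.exp (k * K * (1 / 2) ^ j)) (4 * D / √k * (1 / 2) ^ j) := fun j hj => by
    rw [Finset.mem_range] at hj
    refine ballCover_absconv_shell j hk hc hD (fun i => ?_) (le_trans ?_ (hcount j hj))
    · have := hspec i
      rwa [i.2] at this
    · exact_mod_cast Fintype.card_subtype_mono _ _ fun i hi => by
        have := hgt i (by rw [hi]; exact hj)
        rwa [hi] at this
  have hrest : BallCover (absconv fun i : {i // l i = J} => y i) (Real.exp (k * 4))
      (4 * r * √(1 + L) / √k) := by
    refine ballCover_absconv_small hk hL (le_trans (by positivity) hr) (fun i => ?_) ?_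
    · refine le_trans ?_ hr
      have := hspec i
      rwa [i.2] at this
    · exact le_trans (by exact_mod_cast Fintype.card_subtype_le _) hcard
  have hsum := sum_half_pow_le J
  refine ((BallCover.sum _ hshell).add hrest).mono hsub ?_ ?_
  · rw [← Real.exp_add]
    apply Real.exp_le_exp.2
    rw [← Finset.mul_sum]
    have : (k : ℝ) * K * ∑ j ∈ Finset.range J, (1 / 2 : ℝ) ^ j ≤ k * K * 2 := by
      have : 0 ≤ K := by positivity
      gcongr
    linarith
  · rw [← Finset.mul_sum]
    have : 4 * D / √k * ∑ j ∈ Finset.range J, (1 / 2 : ℝ) ^ j ≤ 4 * D / √k * 2 := by gcongr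
    have h2 : 4 * D / √k * 2 = 8 * D / √k := by ring
    linarith

end Shells

/-! ### Comparison of the resulting radius with the target maximum. -/

section Numerics

variable {n k N : ℕ}

theorem half_le_log_div (hk : 1 ≤ k) (hkn : k ≤ n) (hN : 2 * n ≤ N) :
    1 / 2 ≤ Real.log ((N : ℝ) / k) := by
  have hk' : (0 : ℝ) < k := by exact_mod_cast hk
  have h1 : (2 : ℝ) ≤ N / k := by
    rw [le_div_iff₀ hk']; exact_mod_cast (Nat.mul_le_mul_left 2 hkn).trans hN
  have := Real.log_two_gt_d9
  have := Real.log_le_log (by norm_num) h1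
  linarith

theorem log_div_le (hk : 1 ≤ k) (hkn : k ≤ n) (hN : 2 * n ≤ N)
    (hNe : (N : ℝ) ≤ n * Real.exp k) : Real.log ((N : ℝ) / k) ≤ k + 2 * √n := by
  have hk' : (1 : ℝ) ≤ k := by exact_mod_cast hk
  have hn : (0 : ℝ) < n := by exact_mod_cast lt_of_lt_of_le hk hkn
  have hN0 : (0 : ℝ) < N := by exact_mod_cast (by omega : 0 < N)
  have h1 : (N : ℝ) / k ≤ n * Real.exp k := (div_le_self hN0.le hk').trans hNe
  have h2 := Real.log_le_log (by positivity) h1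
  rw [Real.log_mul hn.ne' (Real.exp_pos _).ne', Real.log_exp] at h2
  have h3 : Real.log n ≤ 2 * √n := by
    have h4 := Real.log_le_sub_one_of_pos (Real.sqrt_pos.2 hn)
    rw [Real.log_sqrt hn.le] at h4
    linarith
  linarith

theorem radius_le (hk : 1 ≤ k) (hkn : k ≤ n) (hN : 2 * n ≤ N) (hNe : (N : ℝ) ≤ n * Real.exp k)
    {L : ℝ} (hL : L = Real.log ((N : ℝ) / k)) :
    √(k + L) * √(1 + L) / k ≤ 8 * (√(n : ℝ) / k + √L / √(k : ℝ)) := by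
  have hk' : (0 : ℝ) < k := by exact_mod_cast hk
  have hL1 := half_le_log_div hk hkn hN
  have hL2 := log_div_le hk hkn hN hNe
  rw [← hL] at hL1 hL2
  have hL0 : 0 ≤ L := by linarith
  have hsk : 0 < √(k : ℝ) := Real.sqrt_pos.2 hk'
  have hsk2 : √(k : ℝ) * √k = k := Real.mul_self_sqrt hk'.le
  have hsL2 : √L * √L = L := Real.mul_self_sqrt hL0
  have hsL := Real.sqrt_nonneg L
  have hsn := Real.sqrt_nonneg (n : ℝ)
  have h1 : √(k + L) ≤ √k + √L := by
    rw [Real.sqrt_le_left (by positivity)]; nlinarith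
  have h2 : √(1 + L) ≤ 2 * √L := by
    rw [Real.sqrt_le_left (by positivity)]; nlinarith
  have h3 : √L / √(k : ℝ) = √L * √k / k := by
    rw [div_eq_div_iff hsk.ne' hk'.ne']; rw [mul_assoc, hsk2]
  rw [h3, ← add_div, ← mul_div_assoc]
  apply div_le_div_of_nonneg_right _ hk'.le
  -- If L ≤ 2k, then √L is at most a multiple of √k. If L > 2k, then L ≤ k + 2√n forces L ≤ 4√n;
  -- this is where N ≤ n eᵏ enters.
  have h4 : L ≤ 2 * (√L * √k) + 4 * √n := by
    rcases le_or_gt L (2 * k) with h | h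
    · have : √L ≤ 2 * √k := by
        rw [Real.sqrt_le_left (by positivity)]; nlinarith
      nlinarith
    · nlinarith [mul_nonneg hsL hsk.le]
  have h5 : √(k + L) * √(1 + L) ≤ (√k + √L) * (2 * √L) := by gcongr
  nlinarith [mul_nonneg hsL hsk.le]

theorem exists_const_le_max_sqrtLogLogLog : ∃ C : ℝ, 0 < C ∧ ∀ n k N : ℕ, 1 ≤ k → k ≤ n →
    2 * n ≤ N →
    √(n : ℝ) / k + √(Real.log ((N : ℝ) / k)) / √(k : ℝ) ≤
      C * max (√(n : ℝ) / k * sqrtLogLogLog ((N : ℝ) / k))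
        (√(Real.log ((N : ℝ) / k)) / √(k : ℝ)) := by
  -- The triple logarithm equals 1 at X₀. Below X₀, n/k ≤ N/k < X₀ bounds √n/k by a multiple of the
  -- second term.
  set X₀ : ℝ := Real.exp (Real.exp (Real.exp 1)) with hX₀
  refine ⟨2 * √X₀ + 2, by positivity, fun n k N hk hkn hN => ?_⟩
  have hk' : (0 : ℝ) < k := by exact_mod_cast hk
  have hL1 := half_le_log_div hk hkn hN
  set X : ℝ := (N : ℝ) / k with hX
  set b := √(Real.log X) / √(k : ℝ) with hb
  have hb0 : 0 ≤ b := by positivity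
  have ha0 : 0 ≤ √(n : ℝ) / k := by positivity
  have hX1 := Real.sqrt_nonneg X₀
  rcases le_or_gt X₀ X with h | h
  · have h1 : 1 ≤ sqrtLogLogLog X := by
      have he : Real.exp 1 ≤ Real.exp (Real.exp 1) := Real.exp_le_exp.2 (by
        linarith [Real.add_one_le_exp (1 : ℝ)])
      rw [sqrtLogLogLog, if_pos ((Real.exp_le_exp.2 he).trans h), Real.one_le_sqrt]
      have hXp : 0 < X := (Real.exp_pos _).trans_le h
      have h1 := (Real.le_log_iff_exp_le hXp).2 h
      have h2 := (Real.le_log_iff_exp_le ((Real.exp_pos _).trans_le h1)).2 h1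
      exact (Real.le_log_iff_exp_le ((Real.exp_pos _).trans_le h2)).2 h2
    have h2 : √(n : ℝ) / k ≤ max (√(n : ℝ) / k * sqrtLogLogLog X) b :=
      (le_mul_of_one_le_right ha0 h1).trans (le_max_left _ _)
    have h3 : b ≤ max (√(n : ℝ) / k * sqrtLogLogLog X) b := le_max_right _ _
    nlinarith
  · have h1 : √(n : ℝ) / k ≤ 2 * √X₀ * b := by
      have hsk : 0 < √(k : ℝ) := Real.sqrt_pos.2 hk'
      have hsk2 : √(k : ℝ) * √k = k := Real.mul_self_sqrt hk'.le
      have h2 : (n : ℝ) / k ≤ X₀ := by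
        refine le_trans ?_ h.le
        rw [hX]
        gcongr
        omega
      have h3 : √(n : ℝ) / √k ≤ √X₀ := by
        rw [← Real.sqrt_div (Nat.cast_nonneg n)]; exact Real.sqrt_le_sqrt h2
      have h4 : 1 ≤ 2 * √(Real.log X) := by
        have : 1 / 2 ≤ √(Real.log X) := Real.le_sqrt_of_sq_le (by linarith)
        linarith
      calc √(n : ℝ) / k = √(n : ℝ) / √k / √k := by rw [div_div, hsk2]
        _ ≤ √X₀ / √k := by gcongr
        _ ≤ √X₀ * (2 * √(Real.log X)) / √k := by
            gcongr; exact le_mul_of_one_le_right hX1 h4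
        _ = 2 * √X₀ * b := by rw [hb]; ring
    have h3 : b ≤ max (√(n : ℝ) / k * sqrtLogLogLog X) b := le_max_right _ _
    nlinarith

end Numerics

/-! ### Exponential moments and tails of Gaussian vectors. -/

section GaussianMoments

theorem lintegral_pi_prod {ι : Type*} [Fintype ι] (μ : Measure ℝ) [IsProbabilityMeasure μ]
    {f : ι → ℝ → ℝ≥0∞} (hf : ∀ i, Measurable (f i)) :
    ∫⁻ x, ∏ i, f i (x i) ∂(Measure.pi fun _ : ι => μ) = ∏ i, ∫⁻ x, f i x ∂μ := by
  have hind : iIndepFun (fun i (x : ι → ℝ) => f i (x i)) (Measure.pi fun _ : ι => μ) :=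
    iIndepFun_pi fun i => (hf i).aemeasurable
  rw [lintegral_prod_eq_prod_lintegral_of_indepFun Finset.univ _ hind
    fun i => (hf i).comp (measurable_pi_apply i)]
  refine Finset.prod_congr rfl fun i _ => ?_
  exact (measurePreserving_eval (fun _ : ι => μ) i).lintegral_comp (hf i)

theorem lintegral_exp_mul_gaussianReal (t : ℝ) :
    ∫⁻ x, ENNReal.ofReal (Real.exp (t * x)) ∂(gaussianReal 0 1) =
      ENNReal.ofReal (Real.exp (t ^ 2 / 2)) := by
  rw [← ofReal_integral_eq_lintegral_ofReal (integrable_exp_mul_gaussianReal t)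
    (Filter.Eventually.of_forall fun x => (Real.exp_pos _).le)]
  congr 1
  have := mgf_gaussianReal (p := gaussianReal 0 1) (X := id) (μ := 0) (v := 1) (by simp) t
  rw [mgf] at this
  simpa using this

theorem lintegral_exp_mul_sq_gaussianReal {a : ℝ} (ha : a < 1 / 2) :
    ∫⁻ x, ENNReal.ofReal (Real.exp (a * x ^ 2)) ∂(gaussianReal 0 1) =
      ENNReal.ofReal (√(1 - 2 * a))⁻¹ := by
  have hb : 0 < 1 / 2 - a := by linarith
  rw [gaussianReal_of_var_ne_zero 0 one_ne_zero,
    lintegral_withDensity_eq_lintegral_mul _ (measurable_gaussianPDF 0 1) (by fun_prop)]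
  have h1 : ∀ x : ℝ, (gaussianPDF 0 1 * fun x => ENNReal.ofReal (Real.exp (a * x ^ 2))) x =
      ENNReal.ofReal ((√(2 * Real.pi))⁻¹ * Real.exp (-(1 / 2 - a) * x ^ 2)) := fun x => by
    rw [Pi.mul_apply, gaussianPDF, ← ENNReal.ofReal_mul (gaussianPDFReal_nonneg 0 1 x),
      gaussianPDFReal, mul_assoc, ← Real.exp_add]
    congr 3
    · simp
    · simp; ring
  simp_rw [h1]
  rw [← ofReal_integral_eq_lintegral_ofReal ((integrable_exp_neg_mul_sq hb).const_mul _)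
    (Filter.Eventually.of_forall fun x => by positivity), integral_const_mul, integral_gaussian]
  congr 1
  have h2 : Real.pi / (1 / 2 - a) = 2 * Real.pi / (1 - 2 * a) := by
    rw [div_eq_div_iff hb.ne' (by linarith)]; ring
  rw [h2, Real.sqrt_div (by positivity)]
  have : 0 < √(2 * Real.pi) := by positivity
  field_simp

variable {ι : Type*} [Fintype ι]

theorem lintegral_stdGaussian_prod {f : ι → ℝ → ℝ≥0∞} (hf : ∀ i, Measurable (f i)) :
    ∫⁻ x, ∏ i, f i (x i) ∂(stdGaussian (EuclideanSpace ℝ ι)) =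
      ∏ i, ∫⁻ x, f i x ∂(gaussianReal 0 1) := by
  rw [← map_pi_eq_stdGaussian, lintegral_map (by fun_prop) (by fun_prop)]
  exact lintegral_pi_prod _ hf

theorem lintegral_exp_mul_norm_sq_stdGaussian {a : ℝ} (ha : a < 1 / 2) :
    ∫⁻ x, ENNReal.ofReal (Real.exp (a * ‖x‖ ^ 2)) ∂(stdGaussian (EuclideanSpace ℝ ι)) =
      ENNReal.ofReal ((√(1 - 2 * a))⁻¹ ^ Fintype.card ι) := by
  have h : ∀ x : EuclideanSpace ℝ ι, ENNReal.ofReal (Real.exp (a * ‖x‖ ^ 2)) =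
      ∏ i, ENNReal.ofReal (Real.exp (a * x i ^ 2)) := fun x => by
    rw [← ENNReal.ofReal_prod_of_nonneg fun i _ => (Real.exp_pos _).le, ← Real.exp_sum,
      ← Finset.mul_sum, EuclideanSpace.real_norm_sq_eq]
  simp_rw [h]
  rw [lintegral_stdGaussian_prod (f := fun _ x => ENNReal.ofReal (Real.exp (a * x ^ 2)))
    fun i => by fun_prop]
  simp_rw [lintegral_exp_mul_sq_gaussianReal ha]
  rw [Finset.prod_const, ENNReal.ofReal_pow (by positivity), Finset.card_univ]

theorem lintegral_exp_inner_stdGaussian (t : EuclideanSpace ℝ ι) :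
    ∫⁻ x, ENNReal.ofReal (Real.exp ⟪t, x⟫) ∂(stdGaussian (EuclideanSpace ℝ ι)) =
      ENNReal.ofReal (Real.exp (‖t‖ ^ 2 / 2)) := by
  have h : ∀ x : EuclideanSpace ℝ ι, ENNReal.ofReal (Real.exp ⟪t, x⟫) =
      ∏ i, ENNReal.ofReal (Real.exp (t i * x i)) := fun x => by
    rw [← ENNReal.ofReal_prod_of_nonneg fun i _ => (Real.exp_pos _).le, ← Real.exp_sum,
      PiLp.inner_apply]
    congr 2
    exact Finset.sum_congr rfl fun i _ => by simp [mul_comm]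
  simp_rw [h]
  rw [lintegral_stdGaussian_prod (f := fun i x => ENNReal.ofReal (Real.exp (t i * x)))
    fun i => by fun_prop]
  simp_rw [lintegral_exp_mul_gaussianReal]
  rw [← ENNReal.ofReal_prod_of_nonneg fun i _ => (Real.exp_pos _).le, ← Real.exp_sum,
    ← Finset.sum_div, EuclideanSpace.real_norm_sq_eq]

variable {κ : Type*} [Fintype κ]

theorem norm_sq_inv_sqrt_two_smul {F : Type*} [NormedAddCommGroup F] [NormedSpace ℝ F] (x : F) :
    ‖(√2 : ℝ)⁻¹ • x‖ ^ 2 / 2 = ‖x‖ ^ 2 / 4 := by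
  rw [norm_smul, mul_pow, Real.norm_eq_abs, sq_abs, inv_pow, Real.sq_sqrt (by norm_num)]
  ring

/-- The quadratic exponent is linearised with an independent Gaussian h: exp(‖Tx‖²/4) is the mean of
exp(⟪Tx, h⟫/√2). Swapping the integrals turns T into its adjoint acting on ℝᵏ, so the bound depends
on k and not on n. -/
theorem lintegral_exp_norm_sq_map_le
    (T : EuclideanSpace ℝ ι →L[ℝ] EuclideanSpace ℝ κ) (hT : ‖T‖ ≤ 1) :
    ∫⁻ x, ENNReal.ofReal (Real.exp (‖T x‖ ^ 2 / 4)) ∂(stdGaussian (EuclideanSpace ℝ ι)) ≤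
      ENNReal.ofReal (√2 ^ Fintype.card κ) := by
  set c : ℝ := (√2)⁻¹ with hc
  calc ∫⁻ x, ENNReal.ofReal (Real.exp (‖T x‖ ^ 2 / 4)) ∂(stdGaussian (EuclideanSpace ℝ ι))
      = ∫⁻ x, ∫⁻ h, ENNReal.ofReal (Real.exp ⟪c • T x, h⟫) ∂(stdGaussian (EuclideanSpace ℝ κ))
          ∂(stdGaussian (EuclideanSpace ℝ ι)) := by
        refine lintegral_congr fun x => ?_
        rw [lintegral_exp_inner_stdGaussian, norm_sq_inv_sqrt_two_smul]
    _ = ∫⁻ h, ∫⁻ x, ENNReal.ofReal (Real.exp ⟪c • T x, h⟫) ∂(stdGaussian (EuclideanSpace ℝ ι))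
          ∂(stdGaussian (EuclideanSpace ℝ κ)) := by
        refine lintegral_lintegral_swap (Continuous.aemeasurable ?_)
        refine ENNReal.continuous_ofReal.comp (Real.continuous_exp.comp ?_)
        exact ((T.continuous.comp continuous_fst).const_smul c).inner continuous_snd
    _ = ∫⁻ h, ENNReal.ofReal (Real.exp (‖T.adjoint h‖ ^ 2 / 4))
          ∂(stdGaussian (EuclideanSpace ℝ κ)) := by
        refine lintegral_congr fun h => ?_
        rw [← norm_sq_inv_sqrt_two_smul, ← lintegral_exp_inner_stdGaussian]
        refine lintegral_congr fun x => ?_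
        rw [inner_smul_left, inner_smul_left, ContinuousLinearMap.adjoint_inner_left,
          real_inner_comm]
    _ ≤ ∫⁻ h, ENNReal.ofReal (Real.exp (1 / 4 * ‖h‖ ^ 2))
          ∂(stdGaussian (EuclideanSpace ℝ κ)) := by
        refine lintegral_mono fun h => ?_
        have h1 : ‖T.adjoint h‖ ≤ ‖h‖ := by
          refine (T.adjoint.le_opNorm h).trans ?_
          rw [LinearIsometryEquiv.norm_map]
          nlinarith [norm_nonneg h]
        have h2 : ‖T.adjoint h‖ ^ 2 ≤ ‖h‖ ^ 2 := by gcongr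
        exact ENNReal.ofReal_le_ofReal (Real.exp_le_exp.2 (by linarith))
    _ = ENNReal.ofReal (√2 ^ Fintype.card κ) := by
        rw [lintegral_exp_mul_norm_sq_stdGaussian (by norm_num)]
        congr 2
        rw [← Real.sqrt_inv]
        norm_num

theorem stdGaussian_le_norm_map_le
    (T : EuclideanSpace ℝ ι →L[ℝ] EuclideanSpace ℝ κ) (hT : ‖T‖ ≤ 1) {s : ℝ} (hs : 0 ≤ s) :
    stdGaussian (EuclideanSpace ℝ ι) {x | s ≤ ‖T x‖} ≤
      ENNReal.ofReal (√2 ^ Fintype.card κ * Real.exp (-(s ^ 2 / 4))) := by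
  have hm := meas_ge_le_lintegral_div (μ := stdGaussian (EuclideanSpace ℝ ι))
    (f := fun x => ENNReal.ofReal (Real.exp (‖T x‖ ^ 2 / 4))) (by fun_prop)
    (ε := ENNReal.ofReal (Real.exp (s ^ 2 / 4))) (by simp [Real.exp_pos]) (by simp)
  refine (measure_mono fun x hx => ?_).trans (hm.trans ?_)
  · have : s ^ 2 ≤ ‖T x‖ ^ 2 := pow_le_pow_left₀ hs hx 2
    exact ENNReal.ofReal_le_ofReal (Real.exp_le_exp.2 (by linarith))
  · rw [Real.exp_neg, ← div_eq_mul_inv, ENNReal.ofReal_div_of_pos (Real.exp_pos _)]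
    gcongr
    exact lintegral_exp_norm_sq_map_le T hT

theorem stdGaussian_two_sqrt_le_norm_le :
    stdGaussian (EuclideanSpace ℝ ι) {x | 2 * √(Fintype.card ι : ℝ) ≤ ‖x‖} ≤
      ENNReal.ofReal (Real.exp (-(Fintype.card ι : ℝ) / 4)) := by
  refine (stdGaussian_le_norm_map_le (.id ℝ _) ContinuousLinearMap.norm_id_le
    (by positivity)).trans (ENNReal.ofReal_le_ofReal ?_)
  have h2 : √2 ≤ Real.exp (1 / 2) := by
    rw [Real.sqrt_le_left (Real.exp_pos _).le, ← Real.exp_nat_mul]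
    have := Real.exp_one_gt_d9
    norm_num at this ⊢
    linarith
  have h3 : √2 ^ Fintype.card ι ≤ Real.exp (Fintype.card ι * (1 / 2)) := by
    rw [Real.exp_nat_mul]; gcongr
  refine (mul_le_mul_of_nonneg_right h3 (Real.exp_pos _).le).trans ?_
  rw [← Real.exp_add, mul_pow, Real.sq_sqrt (Nat.cast_nonneg _)]
  apply Real.exp_le_exp.2
  have : (0 : ℝ) ≤ Fintype.card ι := Nat.cast_nonneg _
  linarith

theorem stdGaussian_norm_le_quarter_sqrt_le :
    stdGaussian (EuclideanSpace ℝ ι) {x | ‖x‖ ≤ √(Fintype.card ι : ℝ) / 4} ≤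
      ENNReal.ofReal (Real.exp (-(Fintype.card ι : ℝ) / 4)) := by
  set d : ℝ := (Fintype.card ι : ℝ) with hd
  have hd0 : 0 ≤ d := Nat.cast_nonneg _
  have hm := meas_ge_le_lintegral_div (μ := stdGaussian (EuclideanSpace ℝ ι))
    -- The exponent -3/2 makes the moment exactly 2⁻ᵈ, and Markov's inequality leaves exp(-d/2 +
    -- 3d/32).
    (f := fun x => ENNReal.ofReal (Real.exp (-(3 / 2) * ‖x‖ ^ 2))) (by fun_prop)
    (ε := ENNReal.ofReal (Real.exp (-(3 / 32) * d))) (by simp [Real.exp_pos]) (by simp)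
  refine (measure_mono fun x hx => ?_).trans (hm.trans ?_)
  · have : ‖x‖ ^ 2 ≤ (√d / 4) ^ 2 := pow_le_pow_left₀ (norm_nonneg x) hx 2
    rw [div_pow, Real.sq_sqrt hd0] at this
    exact ENNReal.ofReal_le_ofReal (Real.exp_le_exp.2 (by linarith))
  · rw [lintegral_exp_mul_norm_sq_stdGaussian (by norm_num),
      ← ENNReal.ofReal_div_of_pos (Real.exp_pos _)]
    apply ENNReal.ofReal_le_ofReal
    have h1 : √(1 - 2 * -(3 / 2)) = (2 : ℝ) := by
      rw [show (1 - 2 * -(3 / 2) : ℝ) = 2 ^ 2 by norm_num, Real.sqrt_sq (by norm_num)]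
    have h2 : (2 : ℝ)⁻¹ ≤ Real.exp (-(1 / 2)) := by
      rw [Real.exp_neg, inv_le_inv₀ (by norm_num) (Real.exp_pos _)]
      have h3 : Real.exp (1 / 2) ^ 2 = Real.exp 1 := by rw [← Real.exp_nat_mul]; norm_num
      have := Real.exp_one_lt_d9
      nlinarith [Real.exp_pos (1 / 2 : ℝ)]
    have h3 : (2 : ℝ)⁻¹ ^ Fintype.card ι ≤ Real.exp (d * -(1 / 2)) := by
      rw [hd, Real.exp_nat_mul]; gcongr
    rw [h1, div_le_iff₀ (Real.exp_pos _), ← Real.exp_add]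
    exact h3.trans (Real.exp_le_exp.2 (by linarith))

end GaussianMoments

/-! ### Nets of the unit ball by volume packing. -/

section Nets

variable {V : Type*} [NormedAddCommGroup V] [NormedSpace ℝ V] [FiniteDimensional ℝ V]

open Metric in
open scoped Function in
theorem Finset.card_le_of_separated_unitBall {ε : ℝ} (hε : 0 < ε) (s : Finset V)
    (hs : ∀ c ∈ s, ‖c‖ ≤ 1) (h : ∀ c ∈ s, ∀ d ∈ s, c ≠ d → ε ≤ ‖c - d‖) :
    (s.card : ℝ) ≤ (1 + 2 / ε) ^ Module.finrank ℝ V := by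
  borelize V
  let μ : Measure V := Measure.addHaar
  have hD : Set.Pairwise (s : Set V) (Disjoint on fun c => ball (c : V) (ε / 2)) := by
    rintro c hc d hd hcd
    apply ball_disjoint_ball
    rw [dist_eq_norm]
    linarith [h c hc d hd hcd]
  have hsub : ⋃ c ∈ s, ball (c : V) (ε / 2) ⊆ ball (0 : V) (1 + ε / 2) := by
    refine Set.iUnion₂_subset fun x hx => ball_subset_ball' ?_
    rw [dist_zero_right]
    linarith [hs x hx]
  have h1 : (s.card : ℝ≥0∞) * ENNReal.ofReal ((ε / 2) ^ Module.finrank ℝ V) * μ (ball 0 1) ≤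
      ENNReal.ofReal ((1 + ε / 2) ^ Module.finrank ℝ V) * μ (ball 0 1) :=
    calc (s.card : ℝ≥0∞) * ENNReal.ofReal ((ε / 2) ^ Module.finrank ℝ V) * μ (ball 0 1)
        = μ (⋃ c ∈ s, ball (c : V) (ε / 2)) := by
          rw [measure_biUnion_finset hD fun c _ => measurableSet_ball]
          simp only [Measure.addHaar_ball_of_pos μ _ (half_pos hε), Finset.sum_const,
            nsmul_eq_mul, mul_assoc]
      _ ≤ μ (ball (0 : V) (1 + ε / 2)) := measure_mono hsub
      _ = _ := by rw [Measure.addHaar_ball_of_pos μ _ (by positivity)]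
  have h2 : (s.card : ℝ≥0∞) * ENNReal.ofReal ((ε / 2) ^ Module.finrank ℝ V) ≤
      ENNReal.ofReal ((1 + ε / 2) ^ Module.finrank ℝ V) := by
    rwa [ENNReal.mul_le_mul_iff_left (measure_ball_pos μ _ zero_lt_one).ne'
      measure_ball_lt_top.ne] at h1
  rw [← ENNReal.ofReal_natCast, ← ENNReal.ofReal_mul (Nat.cast_nonneg _),
    ENNReal.ofReal_le_ofReal_iff (by positivity), ← le_div_iff₀ (by positivity), ← div_pow] at h2
  have h3 : 1 + 2 / ε = (1 + ε / 2) / (ε / 2) := by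
    field_simp
    ring
  rwa [h3]

/-- A separated subset of largest cardinality is a net. Its points lie in the unit ball, so for
operators the net consists of contractions, to which the tail bound applies. -/
theorem exists_finset_net_unitBall {ε : ℝ} (hε : 0 < ε) :
    ∃ F : Finset V, (F.card : ℝ) ≤ (1 + 2 / ε) ^ Module.finrank ℝ V ∧ (∀ y ∈ F, ‖y‖ ≤ 1) ∧
      ∀ x : V, ‖x‖ ≤ 1 → ∃ y ∈ F, ‖x - y‖ ≤ ε := by
  classical
  let S : Set ℕ := {m | ∃ F : Finset V, F.card = m ∧ (∀ y ∈ F, ‖y‖ ≤ 1) ∧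
    ∀ c ∈ F, ∀ d ∈ F, c ≠ d → ε ≤ ‖c - d‖}
  have hne : S.Nonempty := ⟨0, ∅, by simp⟩
  have hbd : BddAbove S := by
    refine ⟨⌊(1 + 2 / ε) ^ Module.finrank ℝ V⌋₊, ?_⟩
    rintro _ ⟨F, rfl, h1, h2⟩
    exact Nat.le_floor (F.card_le_of_separated_unitBall hε h1 h2)
  obtain ⟨F, hF, h1, h2⟩ := Nat.sSup_mem hne hbd
  refine ⟨F, F.card_le_of_separated_unitBall hε h1 h2, h1, fun x hx => ?_⟩
  by_contra! hcon
  have hxF : x ∉ F := fun hxF => by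
    have := hcon x hxF
    simp at this
    linarith
  have hmem : (insert x F).card ∈ S := by
    refine ⟨_, rfl, ?_, ?_⟩
    · intro y hy
      rcases Finset.mem_insert.1 hy with rfl | hy
      exacts [hx, h1 y hy]
    · intro c hc d hd hcd
      rw [Finset.mem_insert] at hc hd
      rcases hc with hc | hc <;> rcases hd with hd | hd
      · exact absurd (hc.trans hd.symm) hcd
      · rw [hc]; exact (hcon d hd).le
      · rw [hd, norm_sub_rev]; exact (hcon c hc).le
      · exact h2 c hc d hd hcd
  have := le_csSup hbd hmem
  rw [Finset.card_insert_of_notMem hxF, hF] at this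
  omega

end Nets

/-! ### Uniform control of the number of long images at each scale. -/

section Scales

/-- The three terms are the net entropy, the logarithmic bound on the number of index sets, and the
tail exponent. The product m s² = 40 k n 2ʲ must beat an entropy of order nk(1 + j); the growth 32ʲ
against s² ~ 16⁻ʲ leaves the needed factor 2ʲ. -/
theorem scale_exponent_le {n k j : ℕ} {L : ℝ} (hk : 1 ≤ k)
    (hscale : 16 * (k + L) ≤ (n : ℝ) * (1 / 16) ^ (j + 1)) (hL : 0 ≤ L) {m : ℕ}
    (hm : m = 640 * k * 32 ^ j) {s : ℝ} (hs : s = (1 / 4) ^ (j + 1) * √(n : ℝ)) :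
    (n * k : ℕ) * (Real.log 20 + j * Real.log 4) + m * (1 + L) + m * (k / 2 - s ^ 2 / 4) ≤
      -(2 * n) := by
  have hk' : (1 : ℝ) ≤ k := by exact_mod_cast hk
  have hs2 : s ^ 2 = n * (1 / 16) ^ (j + 1) := by
    rw [hs, mul_pow, Real.sq_sqrt (Nat.cast_nonneg n), ← pow_mul, mul_comm (j + 1), pow_mul]
    norm_num [mul_comm]
  have h2 := Real.log_two_lt_d9
  have h4 : Real.log 4 ≤ 2 := by
    rw [show (4 : ℝ) = 2 ^ 2 by norm_num, Real.log_pow]; push_cast; linarith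
  have h20 : Real.log 20 ≤ 3 := by
    rw [Real.log_le_iff_le_exp (by norm_num), show (3 : ℝ) = (3 : ℕ) * 1 by norm_num,
      Real.exp_nat_mul]
    have h27 : (2.718 : ℝ) ≤ Real.exp 1 := by linarith [Real.exp_one_gt_d9]
    calc (20 : ℝ) ≤ 2.718 ^ 3 := by norm_num
      _ ≤ Real.exp 1 ^ 3 := by gcongr
  have hm2 : (m : ℝ) * s ^ 2 = 40 * k * n * 2 ^ j := by
    rw [hs2, hm]
    push_cast
    rw [pow_succ, show (32 : ℝ) ^ j = 2 ^ j * 16 ^ j by rw [← mul_pow]; norm_num, one_div, inv_pow]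
    field_simp
    ring
  have hj : (j : ℝ) + 1 ≤ 2 ^ j := by exact_mod_cast j.lt_two_pow_self
  have hm0 : (0 : ℝ) ≤ m := Nat.cast_nonneg m
  have hn0 : (0 : ℝ) ≤ n := Nat.cast_nonneg n
  -- The scale condition says s² ≥ 16(k + L), so half of the Gaussian gain pays for the choice of
  -- indices and for the dimension factor.
  have h5 : (m : ℝ) * (1 + L) + m * (k / 2 - s ^ 2 / 4) ≤ -(m * s ^ 2) / 8 := by
    have : 1 + L + k / 2 ≤ s ^ 2 / 8 := by rw [hs2]; linarith
    nlinarith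
  have h6 : Real.log 20 + j * Real.log 4 ≤ 3 + j * 2 := by gcongr
  have hnk : (0 : ℝ) ≤ (n : ℝ) * k := by positivity
  push_cast
  have h7 : (n : ℝ) * k * (Real.log 20 + j * Real.log 4) ≤ n * k * (5 * 2 ^ j - 2) := by
    have h0 : (0 : ℝ) ≤ j := Nat.cast_nonneg j
    gcongr
    linarith
  rw [hm2] at h5
  nlinarith

variable {Ω : Type*} [MeasurableSpace Ω] {P : Measure Ω} {n k N : ℕ}
  {g : Fin N → Ω → EuclideanSpace ℝ (Fin n)}

theorem measure_iInter_le_norm_map_le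
    (hlaw : ∀ i, HasLaw (g i) (stdGaussian (EuclideanSpace ℝ (Fin n))) P) (hind : iIndepFun g P)
    {T : EuclideanSpace ℝ (Fin n) →L[ℝ] EuclideanSpace ℝ (Fin k)} (hT : ‖T‖ ≤ 1) {s : ℝ}
    (hs : 0 ≤ s) (I : Finset (Fin N)) :
    P (⋂ i ∈ I, g i ⁻¹' {x | s ≤ ‖T x‖}) ≤
      ENNReal.ofReal (Real.exp (I.card * (k / 2 - s ^ 2 / 4))) := by
  have hmeas : MeasurableSet {x | s ≤ ‖T x‖} := measurableSet_le (by fun_prop) (by fun_prop)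
  rw [hind.measure_inter_preimage_eq_mul I (sets := fun _ => {x | s ≤ ‖T x‖}) fun _ _ => hmeas]
  have h2 : √2 ≤ Real.exp (1 / 2) := by
    rw [Real.sqrt_le_left (Real.exp_pos _).le, ← Real.exp_nat_mul]
    have := Real.exp_one_gt_d9
    norm_num at this ⊢
    linarith
  have h1 : ∀ i ∈ I, P (g i ⁻¹' {x | s ≤ ‖T x‖}) ≤
      ENNReal.ofReal (Real.exp (k / 2 - s ^ 2 / 4)) := fun i _ => by
    refine ((hlaw i).measure_eq (p := fun x => s ≤ ‖T x‖) hmeas).le.trans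
      ((stdGaussian_le_norm_map_le T hT hs).trans (ENNReal.ofReal_le_ofReal ?_))
    rw [Fintype.card_fin]
    calc √2 ^ k * Real.exp (-(s ^ 2 / 4)) ≤ Real.exp (1 / 2) ^ k * Real.exp (-(s ^ 2 / 4)) := by
          gcongr
      _ = Real.exp (k / 2 - s ^ 2 / 4) := by
          rw [← Real.exp_nat_mul, ← Real.exp_add]; congr 1; ring
  refine (Finset.prod_le_prod' h1).trans ?_
  rw [Finset.prod_const, ← ENNReal.ofReal_pow (Real.exp_pos _).le, ← Real.exp_nat_mul]

theorem finrank_continuousLinearMap_euclideanSpace (n k : ℕ) :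
    Module.finrank ℝ (EuclideanSpace ℝ (Fin n) →L[ℝ] EuclideanSpace ℝ (Fin k)) = n * k := by
  rw [← (LinearMap.toContinuousLinearMap (𝕜 := ℝ) (E := EuclideanSpace ℝ (Fin n))
    (F' := EuclideanSpace ℝ (Fin k))).finrank_eq, Module.finrank_linearMap]
  simp

/-- With large probability, at the scale `4⁻⁽ʲ⁺¹⁾` every contraction to `ℝᵏ` keeps only few of the
vectors `g i` long. -/
theorem exists_small_event_card_le
    (hlaw : ∀ i, HasLaw (g i) (stdGaussian (EuclideanSpace ℝ (Fin n))) P) (hind : iIndepFun g P)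
    (hk : 1 ≤ k) (hkN : k ≤ N) {L : ℝ} (hL : L = Real.log ((N : ℝ) / k)) (j : ℕ)
    (hscale : 16 * (k + L) ≤ (n : ℝ) * (1 / 16) ^ (j + 1)) :
    ∃ B : Set Ω, P B ≤ ENNReal.ofReal (Real.exp (-(2 * n))) ∧
      ∀ ω ∉ B, (∀ i, ‖g i ω‖ ≤ 2 * √(n : ℝ)) →
        ∀ T : EuclideanSpace ℝ (Fin n) →L[ℝ] EuclideanSpace ℝ (Fin k), ‖T‖ ≤ 1 →
          Fintype.card {i // 2 * √(n : ℝ) * (1 / 4) ^ (j + 1) < ‖T (g i ω)‖} ≤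
            640 * k * 32 ^ j := by
  classical
  have hk' : (0 : ℝ) < k := by exact_mod_cast hk
  have hN' : (0 : ℝ) < N := by exact_mod_cast (by omega : 0 < N)
  have hkN' : (k : ℝ) ≤ N := by exact_mod_cast hkN
  have hL0 : 0 ≤ L := by
    rw [hL]; exact Real.log_nonneg ((one_le_div hk').2 hkN')
  set τ : ℝ := (1 / 4) ^ (j + 1) with hτ
  have hτ0 : 0 < τ := by positivity
  set m := 640 * k * 32 ^ j with hm
  have hm0 : 0 < m := by positivity
  -- With mesh τ/2 and ‖gᵢ‖ ≤ 2√n, passing to the net changes an image by at most τ√n, half of the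
  -- threshold 2τ√n; hence s = τ√n.
  obtain ⟨F, hF, hF1, hFnet⟩ := exists_finset_net_unitBall
    (V := EuclideanSpace ℝ (Fin n) →L[ℝ] EuclideanSpace ℝ (Fin k)) (half_pos hτ0)
  rw [finrank_continuousLinearMap_euclideanSpace] at hF
  set s := τ * √(n : ℝ) with hs
  refine ⟨⋃ T ∈ F, ⋃ I ∈ Finset.powersetCard m Finset.univ, ⋂ i ∈ I, g i ⁻¹' {x | s ≤ ‖T x‖},
    ?_, ?_⟩
  · set q := Real.exp (m * (k / 2 - s ^ 2 / 4)) with hq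
    have hbound : P (⋃ T ∈ F, ⋃ I ∈ Finset.powersetCard m Finset.univ,
        ⋂ i ∈ I, g i ⁻¹' {x | s ≤ ‖T x‖}) ≤ ENNReal.ofReal (F.card * (N.choose m * q)) := by
      refine (measure_biUnion_finset_le _ _).trans ?_
      refine (Finset.sum_le_sum (g := fun _ => ENNReal.ofReal (N.choose m * q))
        fun T hT => ?_).trans (le_of_eq ?_)
      · refine (measure_biUnion_finset_le _ _).trans ?_
        refine (Finset.sum_le_sum (g := fun _ => ENNReal.ofReal q)
          fun I hI => ?_).trans (le_of_eq ?_)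
        · have := measure_iInter_le_norm_map_le hlaw hind (hF1 T hT) (s := s) (by positivity) I
          rwa [(Finset.mem_powersetCard.1 hI).2] at this
        · rw [Finset.sum_const, Finset.card_powersetCard, Finset.card_univ, Fintype.card_fin,
            nsmul_eq_mul, ENNReal.ofReal_mul (Nat.cast_nonneg _), ENNReal.ofReal_natCast]
      · rw [Finset.sum_const, nsmul_eq_mul, ENNReal.ofReal_mul (Nat.cast_nonneg F.card),
          ENNReal.ofReal_natCast]
    refine hbound.trans (ENNReal.ofReal_le_ofReal ?_)
    have h1 : (F.card : ℝ) ≤ Real.exp ((n * k : ℕ) * (Real.log 20 + j * Real.log 4)) := by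
      refine hF.trans ?_
      rw [Real.exp_nat_mul, Real.exp_add, Real.exp_log (by norm_num), Real.exp_nat_mul,
        Real.exp_log (by norm_num)]
      gcongr
      have h41 : (1 : ℝ) ≤ 4 ^ (j + 1) := one_le_pow₀ (by norm_num)
      have : 2 / (τ / 2) = 4 * 4 ^ (j + 1) := by
        rw [hτ, one_div, inv_pow]; field_simp; norm_num
      rw [this]
      rw [pow_succ] at *
      linarith
    have h2 : (N.choose m : ℝ) ≤ Real.exp (m * (1 + L)) := by
      refine (Nat.choose_le_exp_mul_div_pow N hm0).trans ?_
      rw [Real.exp_nat_mul, Real.exp_add, hL, Real.exp_log (by positivity), mul_div_assoc]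
      have hkm : (k : ℝ) ≤ m := by
        have : k ≤ m := by
          rw [hm]
          have : 0 < 32 ^ j := by positivity
          nlinarith
        exact_mod_cast this
      gcongr
    calc (F.card : ℝ) * (N.choose m * q)
        ≤ Real.exp ((n * k : ℕ) * (Real.log 20 + j * Real.log 4)) *
          (Real.exp (m * (1 + L)) * q) := by gcongr
      _ = Real.exp ((n * k : ℕ) * (Real.log 20 + j * Real.log 4) + m * (1 + L) +
          m * (k / 2 - s ^ 2 / 4)) := by rw [hq, ← Real.exp_add, ← Real.exp_add, add_assoc]
      _ ≤ _ := Real.exp_le_exp.2 (scale_exponent_le hk hscale hL0 hm hs)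
  · intro ω hω hbd T hT
    by_contra! hlt
    rw [Fintype.card_subtype] at hlt
    obtain ⟨I, hI, hIc⟩ := Finset.exists_subset_card_eq hlt.le
    obtain ⟨T', hT', hTT'⟩ := hFnet T hT
    refine hω ?_
    simp only [Set.mem_iUnion, Set.mem_iInter]
    refine ⟨T', hT', I, Finset.mem_powersetCard.2 ⟨Finset.subset_univ _, hIc⟩, fun i hi => ?_⟩
    have h1 := (Finset.mem_filter.1 (hI hi)).2
    have h2 : ‖(T - T') (g i ω)‖ ≤ τ / 2 * (2 * √(n : ℝ)) :=
      ((T - T').le_opNorm _).trans (by gcongr; exact hbd i)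
    have h3 : ‖T (g i ω)‖ ≤ ‖T' (g i ω)‖ + ‖(T - T') (g i ω)‖ := by
      have : T (g i ω) = T' (g i ω) + (T - T') (g i ω) := by simp
      rw [this]
      exact norm_add_le _ _
    change s ≤ ‖T' (g i ω)‖
    rw [hs]
    linarith

theorem measure_compl_normEvent_le
    (hlaw : ∀ i, HasLaw (g i) (stdGaussian (EuclideanSpace ℝ (Fin n))) P) :
    P (normEvent n N g)ᶜ ≤ ENNReal.ofReal (2 * N * Real.exp (-(n : ℝ) / 4)) := by
  have hsub : (normEvent n N g)ᶜ ⊆ ⋃ i ∈ (Finset.univ : Finset (Fin N)),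
      ({ω | ‖g i ω‖ ≤ √(n : ℝ) / 4} ∪ {ω | 2 * √(n : ℝ) ≤ ‖g i ω‖}) := fun ω hω => by
    simp only [normEvent, Set.mem_compl_iff, Set.mem_ofPred_eq, not_forall] at hω
    obtain ⟨i, hi⟩ := hω
    simp only [Set.mem_iUnion]
    refine ⟨i, Finset.mem_univ i, ?_⟩
    by_contra hcon
    simp only [Set.mem_union, Set.mem_ofPred_eq, not_or, not_le] at hcon
    exact hi ⟨hcon.1.le, hcon.2.le⟩
  have hi : ∀ i : Fin N, P ({ω | ‖g i ω‖ ≤ √(n : ℝ) / 4} ∪ {ω | 2 * √(n : ℝ) ≤ ‖g i ω‖}) ≤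
      ENNReal.ofReal (2 * Real.exp (-(n : ℝ) / 4)) := fun i => by
    refine (measure_union_le _ _).trans ?_
    rw [two_mul (Real.exp _), ENNReal.ofReal_add (Real.exp_pos _).le (Real.exp_pos _).le]
    have h1 := stdGaussian_norm_le_quarter_sqrt_le (ι := Fin n)
    have h2 := stdGaussian_two_sqrt_le_norm_le (ι := Fin n)
    rw [Fintype.card_fin] at h1 h2
    refine add_le_add ?_ ?_
    · exact ((hlaw i).measure_eq (p := fun x => ‖x‖ ≤ √(n : ℝ) / 4)
        (measurableSet_le (by fun_prop) (by fun_prop))).le.trans h1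
    · exact ((hlaw i).measure_eq (p := fun x => 2 * √(n : ℝ) ≤ ‖x‖)
        (measurableSet_le (by fun_prop) (by fun_prop))).le.trans h2
  refine (measure_mono hsub).trans ((measure_biUnion_finset_le _ _).trans
    ((Finset.sum_le_sum fun i _ => hi i).trans (le_of_eq ?_)))
  rw [Finset.sum_const, Finset.card_univ, Fintype.card_fin, nsmul_eq_mul,
    ← ENNReal.ofReal_natCast, ← ENNReal.ofReal_mul (Nat.cast_nonneg _)]
  congr 1; ring

theorem exists_event_card_le [IsProbabilityMeasure P]
    (hlaw : ∀ i, HasLaw (g i) (stdGaussian (EuclideanSpace ℝ (Fin n))) P) (hind : iIndepFun g P)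
    (hk : 1 ≤ k) (hkN : k ≤ N) (hn : 1 ≤ n) {L : ℝ} (hL : L = Real.log ((N : ℝ) / k)) :
    ∃ Ω₁ : Set Ω, MeasurableSet Ω₁ ∧ Ω₁ ⊆ normEvent n N g ∧
      1 - 4 * (N : ℝ) * Real.exp (-(n : ℝ) / 4) ≤ P.real Ω₁ ∧
      ∀ ω ∈ Ω₁, ∀ T : EuclideanSpace ℝ (Fin n) →L[ℝ] EuclideanSpace ℝ (Fin k), ‖T‖ ≤ 1 →
        ∀ j < n, 16 * (k + L) ≤ (n : ℝ) * (1 / 16) ^ (j + 1) →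
          Fintype.card {i // 2 * √(n : ℝ) * (1 / 4) ^ (j + 1) < ‖T (g i ω)‖} ≤
            640 * k * 32 ^ j := by
  have hex : ∀ j : ℕ, ∃ B : Set Ω, P B ≤ ENNReal.ofReal (Real.exp (-(2 * n))) ∧
      (16 * (k + L) ≤ (n : ℝ) * (1 / 16) ^ (j + 1) →
      ∀ ω ∉ B, (∀ i, ‖g i ω‖ ≤ 2 * √(n : ℝ)) →
        ∀ T : EuclideanSpace ℝ (Fin n) →L[ℝ] EuclideanSpace ℝ (Fin k), ‖T‖ ≤ 1 →
          Fintype.card {i // 2 * √(n : ℝ) * (1 / 4) ^ (j + 1) < ‖T (g i ω)‖} ≤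
            640 * k * 32 ^ j) := fun j => by
    by_cases h : 16 * (k + L) ≤ (n : ℝ) * (1 / 16) ^ (j + 1)
    · obtain ⟨B, h1, h2⟩ := exists_small_event_card_le hlaw hind hk hkN hL j h
      exact ⟨B, h1, fun _ => h2⟩
    · exact ⟨∅, by simp, fun h' => absurd h' h⟩
  choose B hB hBc using hex
  set bad : Set Ω := (normEvent n N g)ᶜ ∪ ⋃ j ∈ Finset.range n, B j with hbad
  have hPbad : P bad ≤ ENNReal.ofReal (4 * N * Real.exp (-(n : ℝ) / 4)) := by
    have h1 : P (⋃ j ∈ Finset.range n, B j) ≤ ENNReal.ofReal (n * Real.exp (-(2 * n))) := by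
      refine (measure_biUnion_finset_le _ _).trans
        ((Finset.sum_le_sum fun j _ => hB j).trans (le_of_eq ?_))
      rw [Finset.sum_const, Finset.card_range, nsmul_eq_mul, ENNReal.ofReal_mul (Nat.cast_nonneg _),
        ENNReal.ofReal_natCast]
    refine (measure_union_le _ _).trans
      ((add_le_add (measure_compl_normEvent_le hlaw) h1).trans ?_)
    rw [← ENNReal.ofReal_add (by positivity) (by positivity)]
    apply ENNReal.ofReal_le_ofReal
    have hN1 : (1 : ℝ) ≤ N := by exact_mod_cast hk.trans hkN
    have h2 : (n : ℝ) * Real.exp (-(2 * n)) ≤ Real.exp (-(n : ℝ) / 4) := by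
      have h3 : (n : ℝ) ≤ Real.exp n := by linarith [Real.add_one_le_exp (n : ℝ)]
      calc (n : ℝ) * Real.exp (-(2 * n)) ≤ Real.exp n * Real.exp (-(2 * n)) := by gcongr
        _ = Real.exp (-n) := by rw [← Real.exp_add]; congr 1; ring
        _ ≤ _ := Real.exp_le_exp.2 (by linarith [(Nat.cast_nonneg n : (0 : ℝ) ≤ n)])
    nlinarith [Real.exp_pos (-(n : ℝ) / 4)]
  -- The bad set need not be measurable; the complement of its measurable hull is a measurable event
  -- with the same probability bound.
  have hsub := subset_toMeasurable P bad
  refine ⟨(toMeasurable P bad)ᶜ, (measurableSet_toMeasurable _ _).compl, ?_, ?_, ?_⟩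
  · intro ω hω
    by_contra h
    exact hω (hsub (Or.inl h))
  · rw [probReal_compl_eq_one_sub (measurableSet_toMeasurable _ _), measureReal_def,
      measure_toMeasurable]
    have := ENNReal.toReal_le_of_le_ofReal (by positivity) hPbad
    linarith
  · intro ω hω T hT j hj hscale
    refine hBc j hscale ω (fun h => hω (hsub (Or.inr ?_))) (fun i => ?_) T hT
    · simp only [Set.mem_iUnion]
      exact ⟨j, Finset.mem_range.2 hj, h⟩
    · by_contra h
      exact hω (hsub (Or.inl fun h' => h (h' i).2))

end Scales

/-! ### Reduction of projections to contractions onto ℝᵏ. -/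

section Projections

variable {n k : ℕ}

/-- An orthogonal projection of rank `k` factors as a coisometry onto `ℝᵏ` followed by an
isometric embedding. -/
theorem exists_factorization_of_mem_orthProjections
    {Q : EuclideanSpace ℝ (Fin n) →L[ℝ] EuclideanSpace ℝ (Fin n)} (hQ : Q ∈ orthProjections n k) :
    ∃ (T : EuclideanSpace ℝ (Fin n) →L[ℝ] EuclideanSpace ℝ (Fin k))
      (e : EuclideanSpace ℝ (Fin k) →ₗᵢ[ℝ] EuclideanSpace ℝ (Fin n)), ‖T‖ ≤ 1 ∧
      (∀ x, Q x = e (T x)) ∧ ∑ i, ‖T (EuclideanSpace.single i 1)‖ ^ 2 = k := by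
  obtain ⟨hstar, hrank⟩ := hQ
  obtain ⟨_, hQeq⟩ := isStarProjection_iff_eq_starProjection_range.1 hstar
  set K : Submodule ℝ (EuclideanSpace ℝ (Fin n)) := LinearMap.range Q.toLinearMap with hK
  let b : OrthonormalBasis (Fin k) ℝ K := (stdOrthonormalBasis ℝ K).reindex (finCongr hrank)
  let T : EuclideanSpace ℝ (Fin n) →L[ℝ] EuclideanSpace ℝ (Fin k) :=
    (b.repr.toContinuousLinearEquiv : K →L[ℝ] EuclideanSpace ℝ (Fin k)).comp
      K.orthogonalProjectionOnto
  have hTx : ∀ x, T x = b.repr (K.orthogonalProjectionOnto x) := fun x => rfl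
  refine ⟨T, K.subtypeₗᵢ.comp b.repr.symm.toLinearIsometry, ?_, ?_, ?_⟩
  · refine T.opNorm_le_bound zero_le_one fun x => ?_
    rw [hTx, LinearIsometryEquiv.norm_map, one_mul]
    exact K.norm_orthogonalProjectionOnto_apply_le x
  · intro x
    conv_lhs => rw [hQeq]
    simp [hTx]
    rfl
  · have h1 : ∀ x, ‖T x‖ ^ 2 = ∑ l, ⟪x, (b l : EuclideanSpace ℝ (Fin n))⟫ ^ 2 := fun x => by
      rw [EuclideanSpace.real_norm_sq_eq]
      refine Finset.sum_congr rfl fun l _ => ?_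
      rw [hTx, b.repr_apply_apply, real_inner_comm,
        Submodule.inner_orthogonalProjectionOnto_eq_of_mem_right]
    simp_rw [h1]
    rw [Finset.sum_comm]
    have h2 : ∀ l, ∑ i, ⟪(EuclideanSpace.single i 1 : EuclideanSpace ℝ (Fin n)),
        (b l : EuclideanSpace ℝ (Fin n))⟫ ^ 2 = 1 := fun l => by
      have := (EuclideanSpace.basisFun (Fin n) ℝ).sum_sq_inner_right
        (b l : EuclideanSpace ℝ (Fin n))
      simp only [EuclideanSpace.basisFun_apply] at this
      rw [this, ← Submodule.coe_norm, b.norm_eq_one, one_pow]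
    simp [h2]

/-- Markov's inequality for ∑‖T eᵢ‖² = k, with no probability involved; it yields 16ʲ, weakened to
32ʲ to match the Gaussian count. -/
theorem card_lt_norm_map_basis_le {T : EuclideanSpace ℝ (Fin n) →L[ℝ] EuclideanSpace ℝ (Fin k)}
    (hT : ∑ i, ‖T (EuclideanSpace.single i 1)‖ ^ 2 = k) (j : ℕ) :
    (Fintype.card {i // 2 * √(n : ℝ) * (1 / 4) ^ (j + 1) <
      ‖T (√(n : ℝ) • EuclideanSpace.single i 1)‖} : ℝ) ≤ 4 * k * 32 ^ j := by
  classical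
  rcases Nat.eq_zero_or_pos n with rfl | hn
  · simp
  have hn' : 0 < √(n : ℝ) := Real.sqrt_pos.2 (by exact_mod_cast hn)
  rw [Fintype.card_subtype]
  set S := Finset.univ.filter fun i : Fin n => 2 * √(n : ℝ) * (1 / 4) ^ (j + 1) <
      ‖T (√(n : ℝ) • EuclideanSpace.single i 1)‖ with hS
  have h1 : ∀ i ∈ S, 4 * (1 / 16 : ℝ) ^ (j + 1) ≤ ‖T (EuclideanSpace.single i 1)‖ ^ 2 :=
    fun i hi => by
      have h := (Finset.mem_filter.1 hi).2
      rw [map_smul, norm_smul, Real.norm_of_nonneg hn'.le] at h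
      have h2 : 2 * (1 / 4 : ℝ) ^ (j + 1) ≤ ‖T (EuclideanSpace.single i 1)‖ := by
        by_contra! hcon
        have := mul_lt_mul_of_pos_left hcon hn'
        linarith
      have h3 : (2 * (1 / 4 : ℝ) ^ (j + 1)) ^ 2 ≤ ‖T (EuclideanSpace.single i 1)‖ ^ 2 := by gcongr
      refine le_trans (le_of_eq ?_) h3
      rw [mul_pow, ← pow_mul, mul_comm (j + 1), pow_mul]
      norm_num
  have h2 : (S.card : ℝ) * (4 * (1 / 16 : ℝ) ^ (j + 1)) ≤ k := by
    rw [← hT, ← nsmul_eq_mul, ← Finset.sum_const]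
    exact (Finset.sum_le_sum h1).trans
      (Finset.sum_le_sum_of_subset_of_nonneg (Finset.subset_univ _) fun _ _ _ => by positivity)
  have h3 : (S.card : ℝ) ≤ 4 * k * 16 ^ j := by
    have h4 : (S.card : ℝ) = S.card * (4 * (1 / 16 : ℝ) ^ (j + 1)) * (4 * 16 ^ j) := by
      rw [pow_succ, one_div, inv_pow]; field_simp; norm_num
    rw [h4]
    calc (S.card : ℝ) * (4 * (1 / 16 : ℝ) ^ (j + 1)) * (4 * 16 ^ j) ≤ k * (4 * 16 ^ j) := by gcongr
      _ = _ := by ring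
  refine h3.trans ?_
  gcongr
  norm_num

theorem image_absconv {ι E F : Type*} [Fintype ι] [NormedAddCommGroup E] [NormedSpace ℝ E]
    [NormedAddCommGroup F] [NormedSpace ℝ F] (T : E →L[ℝ] F) (v : ι → E) :
    T '' absconv v = absconv fun i => T (v i) := by
  ext y
  constructor
  · rintro ⟨_, ⟨a, ha, rfl⟩, rfl⟩
    exact ⟨a, ha, by simp⟩
  · rintro ⟨a, ha, rfl⟩
    exact ⟨_, ⟨a, ha, rfl⟩, by simp⟩

end Projections

/-! ### Choice of the last scale and assembly. -/

/-- J is the first scale at which the union bound is no longer available; its failure says that the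
remaining vectors have length O(√(k + L)). The bound j < n keeps the scales within the n bad events
already excluded. -/
theorem exists_nat_scale {n k : ℕ} (hk : 1 ≤ k) {L : ℝ} (hL : 0 ≤ L) :
    ∃ J : ℕ, (∀ j < J, j < n ∧ 16 * (k + L) ≤ (n : ℝ) * (1 / 16) ^ (j + 1)) ∧
      2 * √(n : ℝ) * (1 / 4) ^ J ≤ 32 * √(k + L) := by
  classical
  have hk' : (1 : ℝ) ≤ k := by exact_mod_cast hk
  have hlt : ∀ j : ℕ, 16 * (k + L) ≤ (n : ℝ) * (1 / 16) ^ (j + 1) → j < n := fun j h => by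
    have h1 : (j : ℝ) < 16 ^ (j + 1) := by
      exact_mod_cast (Nat.lt_pow_self (by norm_num)).trans
        (Nat.pow_lt_pow_right (by norm_num) j.lt_succ_self)
    have h2 : (16 : ℝ) ^ (j + 1) ≤ n := by
      have h3 : 1 ≤ (n : ℝ) * (1 / 16) ^ (j + 1) := by linarith
      rw [one_div, inv_pow, ← div_eq_mul_inv, one_le_div (by positivity)] at h3
      exact h3
    exact_mod_cast h1.trans_le h2
  have hex : ∃ j : ℕ, (n : ℝ) * (1 / 16) ^ (j + 1) < 16 * (k + L) := by
    by_contra! h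
    exact lt_irrefl _ (hlt n (h n))
  refine ⟨Nat.find hex, fun j hj => ?_, ?_⟩
  · have := not_lt.1 (Nat.find_min hex hj)
    exact ⟨hlt j this, this⟩
  · have h := Nat.find_spec hex
    set J := Nat.find hex
    have h1 : √(n : ℝ) * (1 / 4) ^ J ≤ 16 * √(k + L) := by
      refine le_of_sq_le_sq ?_ (by positivity)
      rw [mul_pow, mul_pow, Real.sq_sqrt (Nat.cast_nonneg n), Real.sq_sqrt (by positivity),
        ← pow_mul, mul_comm J, pow_mul]
      rw [pow_succ] at h
      norm_num at h ⊢
      linarith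
    linarith

theorem theorem3p5 :
    ∃ C : ℝ, 0 < C ∧
      ∀ (n k N : ℕ), 1 ≤ k → k ≤ n → 2 * n ≤ N → (N : ℝ) ≤ n * Real.exp k →
      ∀ (Ω : Type*) [MeasurableSpace Ω] (P : Measure Ω) [IsProbabilityMeasure P]
        (g : Fin N → Ω → EuclideanSpace ℝ (Fin n)),
        (∀ i, HasLaw (g i) (stdGaussian (EuclideanSpace ℝ (Fin n))) P) →
        iIndepFun g P →
        ∃ Ω₁ : Set Ω, MeasurableSet Ω₁ ∧ Ω₁ ⊆ normEvent n N g ∧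
          1 - 4 * (N : ℝ) * Real.exp (-(n : ℝ) / 4) ≤ P.real Ω₁ ∧
          ∀ ω ∈ Ω₁, ∀ Q ∈ orthProjections n k,
            (μHE[k] (Q '' gluskinPolytope n N (fun i => g i ω))) ^ (1 / (k : ℝ)) ≤
              ENNReal.ofReal (C * max (√(n : ℝ) / k * sqrtLogLogLog ((N : ℝ) / k))
                (√(Real.log ((N : ℝ) / k)) / √(k : ℝ))) := by
  obtain ⟨C₁, hC₁, hmax⟩ := exists_const_le_max_sqrtLogLogLog
  set K : ℝ := 2 * (Real.log (6 * Real.exp 1 * 644) + 5) + 4 with hKdef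
  set A : ℝ := Real.exp K * (Real.exp 1 * √Real.pi) with hA
  have hA0 : 0 < A := by positivity
  refine ⟨A * 1040 * C₁, by positivity, ?_⟩
  intro n k N hk hkn hN hNe Ω _ P _ g hlaw hind
  have hkN : k ≤ N := by omega
  have hk' : (0 : ℝ) < k := by exact_mod_cast hk
  have hsk : 0 < √(k : ℝ) := Real.sqrt_pos.2 hk'
  have hn' : (0 : ℝ) < n := by exact_mod_cast hk.trans hkn
  have hN' : (0 : ℝ) < N := by exact_mod_cast (by omega : 0 < N)
  set L := Real.log ((N : ℝ) / k) with hL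
  have hL0 : 0 ≤ L := by linarith [half_le_log_div hk hkn hN]
  obtain ⟨Ω₁, hmeas, hsub, hprob, hcard⟩ :=
    exists_event_card_le hlaw hind hk hkN (hk.trans hkn) hL
  refine ⟨Ω₁, hmeas, hsub, hprob, fun ω hω Q hQ => ?_⟩
  obtain ⟨T, e, hT, hQT, hTsum⟩ := exists_factorization_of_mem_orthProjections hQ
  obtain ⟨J, hJ, hJr⟩ := exists_nat_scale (n := n) hk hL0
  set v : Fin n ⊕ Fin N → EuclideanSpace ℝ (Fin n) := Sum.elim
    (fun i : Fin n => √(n : ℝ) • (EuclideanSpace.single i 1 : EuclideanSpace ℝ (Fin n)))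
    (fun i => g i ω) with hv
  set y : Fin n ⊕ Fin N → EuclideanSpace ℝ (Fin k) := fun i => T (v i) with hy
  have hvol : μHE[k] (Q '' gluskinPolytope n N (fun i => g i ω)) = volume (absconv y) := by
    have h1 : Q '' gluskinPolytope n N (fun i => g i ω) = e '' absconv y := by
      rw [hy, ← image_absconv T v, Set.image_image]
      exact Set.image_congr fun x _ => hQT x
    rw [h1, e.isometry.euclideanHausdorffMeasure_image,
      EuclideanSpace.euclideanHausdorffMeasure_eq_volume]
  have hynorm : ∀ i, ‖y i‖ ≤ 2 * √(n : ℝ) := fun i => by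
    have h1 : ‖y i‖ ≤ ‖v i‖ := by
      refine (T.le_opNorm _).trans ?_
      nlinarith [norm_nonneg (v i)]
    refine h1.trans ?_
    rcases i with i | i
    · simp only [hv, Sum.elim_inl, norm_smul, PiLp.norm_single, norm_one, mul_one,
        Real.norm_of_nonneg (Real.sqrt_nonneg _)]
      linarith [Real.sqrt_nonneg (n : ℝ)]
    · exact ((hsub hω) i).2
  -- 644 = 4 + 640: basis vectors plus Gaussian vectors.
  have hcount : ∀ j < J, (Fintype.card {i // 2 * √(n : ℝ) * (1 / 4) ^ (j + 1) < ‖y i‖} : ℝ) ≤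
      644 * k * 32 ^ j := fun j hj => by
    have h1 := card_lt_norm_map_basis_le hTsum j
    have h2 := hcard ω hω T hT j (hJ j hj).1 (hJ j hj).2
    have h3 : Fintype.card {i // 2 * √(n : ℝ) * (1 / 4) ^ (j + 1) < ‖y i‖} =
        Fintype.card {i // 2 * √(n : ℝ) * (1 / 4) ^ (j + 1) <
          ‖T (√(n : ℝ) • EuclideanSpace.single i 1)‖} +
        Fintype.card {i // 2 * √(n : ℝ) * (1 / 4) ^ (j + 1) < ‖T (g i ω)‖} := by
      rw [← Fintype.card_sum]
      exact Fintype.card_congr Equiv.subtypeSum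
    have h4 : (Fintype.card {i // 2 * √(n : ℝ) * (1 / 4) ^ (j + 1) < ‖T (g i ω)‖} : ℝ) ≤
        640 * k * 32 ^ j := by exact_mod_cast h2
    rw [h3]
    push_cast
    linarith
  have hcardι : (Fintype.card (Fin n ⊕ Fin N) : ℝ) ≤ 2 * k * Real.exp L := by
    rw [hL, Real.exp_log (by positivity), Fintype.card_sum, Fintype.card_fin, Fintype.card_fin]
    have h1 : 2 * (k : ℝ) * (N / k) = 2 * N := by field_simp
    rw [h1]
    have : n + N ≤ 2 * N := by omega
    exact_mod_cast this
  have hcover := ballCover_absconv_of_shells hk (c := 644) (by norm_num) hL0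
    (by positivity) hynorm hcount hJr hcardι
  rw [← hKdef] at hcover
  set ρ : ℝ := 8 * (2 * √(n : ℝ)) / √k + 4 * (32 * √(k + L)) * √(1 + L) / √k with hρ
  have hρ0 : 0 < ρ := by positivity
  have hvolle := hcover.volume_le hk hρ0
  have hpow : Real.exp (k * K) * (Real.exp 1 * √Real.pi * ρ / √k) ^ k = (A * (ρ / √k)) ^ k := by
    rw [Real.exp_nat_mul, ← mul_pow, hA]; congr 1; ring
  rw [hpow] at hvolle
  have hroot : (volume (absconv y)) ^ (1 / (k : ℝ)) ≤ ENNReal.ofReal (A * (ρ / √k)) := by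
    refine (ENNReal.rpow_le_rpow hvolle (by positivity)).trans (le_of_eq ?_)
    rw [ENNReal.ofReal_pow (by positivity), ← ENNReal.rpow_natCast, ← ENNReal.rpow_mul,
      mul_one_div_cancel hk'.ne', ENNReal.rpow_one]
  rw [hvol]
  refine hroot.trans (ENNReal.ofReal_le_ofReal ?_)
  have hrad := radius_le hk hkn hN hNe hL
  have hm := hmax n k N hk hkn hN
  rw [← hL] at hm
  have hsk2 : √(k : ℝ) * √k = k := Real.mul_self_sqrt hk'.le
  have hρk : ρ / √k = 16 * (√(n : ℝ) / k) + 128 * (√(k + L) * √(1 + L) / k) := by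
    rw [hρ, ← add_div, div_div, hsk2]; ring
  -- 1040 = 16 + 128 · 8, the 8 coming from `radius_le`.
  have hfin : ρ / √k ≤ 1040 * (√(n : ℝ) / k + √L / √(k : ℝ)) := by
    have : 0 ≤ √L / √(k : ℝ) := by positivity
    rw [hρk]
    linarith
  calc A * (ρ / √k) ≤ A * (1040 * (√(n : ℝ) / k + √L / √(k : ℝ))) := by gcongr
    _ ≤ A * (1040 * (C₁ * _)) := by gcongr
    _ = _ := by ring
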